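/- A function $\phi:(0,\infty)\to(0,\infty)$ is called admissible if $\phi$ and $\psi(r)=r/\phi(r)$ are both positive and non-decreasing on $(0,\infty)$ and $\psi(0^+)=0$. For $0<\alpha<1$ let $\mathrm{Lip}_\alpha(\mathbb C)$ be the space of bounded functions $f:\mathbb C\to\mathbb C$ with finite norm $\|f\|_{\mathrm{Lip}_\alpha}=\sup_{z\ne w}\frac{|f(z)-f(w)|}{|z-w|^\alpha}+\sup_{z}|f(z)|$, and let $\mathrm{lip}_\alpha(\mathbb C)$ consist of those $f\in \mathrm{Lip}_\alpha(\mathbb C)$ with $\lim_{\delta\to0^+}\sup_{0<|z-w|<\delta}\frac{|f(z)-f(w)|}{|z-w|^\alpha}=0$. For $U\subseteq\mathbb C$ let $A_\alpha(U)$ be the set of $f\in\mathrm{lip}_\alpha(\mathbb C)$ that are analytic in a neighborhood of $U$. A set $E\subseteq\mathbb C$ has full area density at $0$ if $m(B(0,r)\setminus E)/m(B(0,r))\to0$ as $r\to0^+$, where $m$ is two-dimensional Lebesgue (outer) measure. Let $A_n(0)=\{z:2^{-(n+1)}\le|z|\le2^{-n}\}$. A measure function is a non-decreasing $h:[0,\infty)\to[0,\infty)$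 with $h(t)\to0$ as $t\to0$; put $M^h(E)=\inf\sum_j h(s_j)$ over all countable covers of $E$ by squares with side lengths $s_j$, and let $M_*^{1+\alpha}(E)=\sup_h M^h(E)$ over all measure functions $h$ with $h(t)\le t^{1+\alpha}$ and $h(t)t^{-(1+\alpha)}\to0$ as $t\to0^+$. Theorem. Let $\phi$ be admissible with $\phi(0^+)=0$ and let $0<\alpha<1$. Then there are integers $1\le k_1<k_2<\cdots$ such that, with $a_n=\frac34 2^{-k_n}$ and $r_n>0$ defined by $r_n^{1+\alpha}=a_n^2n^{-1}\phi(a_n)$, each closed disk $\overline{B(a_n,r_n)}$ is contained in $A_{k_n}(0)$, and the set $$U=\{|z|<1\}\setminus\bigcup_{n=1}^\infty\overline{B(a_n,r_n)}$$ contains $0$, $U\setminus\{0\}$ is open, and the following hold: 1. for each $\epsilon>0$ the set $\{y\in U:\ |f(y)-f(0)-f'(0)y|\le\epsilon\,\phi(|y|)\,|y|\,\|f\|_{\mathrm{Lip}_\alpha}\ \text{for all } f\in A_\alpha(U)\}$ has full area density at $0$ (at $y=0$ the right-hand side is read as $0$); 2. $\displaystyle\sum_{n=1}^\infty\phi(2^{-n})^{-1}4^nM_*^{1+\alpha}(A_n(0)\setminus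 U)=\infty.$ -/

import Mathlib

open Set Filter Topology MeasureTheory Metric
open scoped NNReal ENNReal

noncomputable section

namespace LipAnalytic

/-- Admissible functions on `(0, ∞)`: `φ` is positive and non-decreasing, and the associated
function `ψ(r) = r / φ(r)` is positive and non-decreasing with `ψ(0⁺) = 0`. The values of `φ`
outside `(0, ∞)` play no role. -/
structure IsAdmissible (φ : ℝ → ℝ) : Prop where
  pos : ∀ r, 0 < r → 0 < φ r
  mono : MonotoneOn φ (Ioi 0)
  assoc_pos : ∀ r, 0 < r → 0 < r / φ r
  assoc_mono : MonotoneOn (fun r => r / φ r) (Ioi 0)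
  assoc_tendsto : Tendsto (fun r => r / φ r) (𝓝[>] 0) (𝓝 0)

/-- The closed dyadic annulus `A_n(x) = {z : 2^{-(n+1)} ≤ |z - x| ≤ 2^{-n}}`. -/
def annulus (x : ℂ) (n : ℕ) : Set ℂ :=
  {z | ((2 : ℝ) ^ (n + 1))⁻¹ ≤ ‖z - x‖ ∧ ‖z - x‖ ≤ ((2 : ℝ) ^ n)⁻¹}

/-- `E` has full area density at `x`. -/
def HasFullAreaDensity (E : Set ℂ) (x : ℂ) : Prop :=
  Tendsto (fun r : ℝ => volume (ball x r \ E) / volume (ball x r)) (𝓝[>] 0) (𝓝 0)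

/-- `f ∈ Lip_α(ℂ)`: `f` is bounded and `α`-Hölder on all of `ℂ`. -/
def MemLip (α : ℝ≥0) (f : ℂ → ℂ) : Prop :=
  MemHolder α f ∧ BddAbove (range fun z => ‖f z‖)

/-- The norm of `Lip_α(ℂ)`: the least Hölder constant plus the supremum norm. -/
def lipNorm (α : ℝ≥0) (f : ℂ → ℂ) : ℝ :=
  (nnHolderNorm α f : ℝ) + ⨆ z, ‖f z‖

/-- `f ∈ lip_α(ℂ)`, the little Lipschitz class. -/
def MemLittleLip (α : ℝ≥0) (f : ℂ → ℂ) : Prop :=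
  MemLip α f ∧ ∀ ε : ℝ, 0 < ε → ∃ δ : ℝ, 0 < δ ∧
    ∀ z w : ℂ, 0 < ‖z - w‖ → ‖z - w‖ < δ → ‖f z - f w‖ / ‖z - w‖ ^ (α : ℝ) ≤ ε

/-- `A_α(U)`: the functions of the little Lipschitz class that are analytic in a neighbourhood
of `U`. The set `U` need not be open; for open `U` this says that `f` is analytic on `U`. -/
def analyticLip (α : ℝ≥0) (U : Set ℂ) : Set (ℂ → ℂ) :=
  {f | MemLittleLip α f ∧ AnalyticOnNhd ℂ f U}

/-- The closed square with centre `c`, side length `s`, and sides parallel to the complex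
numbers `u` and `i u`, for `u` of modulus one. -/
def square (c : ℂ) (u : Circle) (s : ℝ≥0) : Set ℂ :=
  (fun z : ℂ => c + u * z) '' {z | |z.re| ≤ (s : ℝ) / 2 ∧ |z.im| ≤ (s : ℝ) / 2}

/-- A measure function: non-decreasing on `[0, ∞)` with `h(t) → 0` as `t → 0`. -/
def IsMeasureFunction (h : ℝ≥0 → ℝ≥0) : Prop :=
  Monotone h ∧ Tendsto h (𝓝 0) (𝓝 0)

/-- The Hausdorff content `M^h(E)`, an infimum over countable covers of `E` by squares. Squares
of side `0`, which have weight `h 0 = 0`, are allowed so that finite covers are included; since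
`h(t) → 0` as `t → 0` they do not change the infimum. -/
def hausdorffContent (h : ℝ≥0 → ℝ≥0) (E : Set ℂ) : ℝ≥0∞ :=
  ⨅ (c : ℕ → ℂ) (u : ℕ → Circle) (s : ℕ → ℝ≥0) (_ : E ⊆ ⋃ j, square (c j) (u j) (s j)),
    ∑' j, (h (s j) : ℝ≥0∞)

/-- The lower `β`-dimensional Hausdorff content `M_*^β(E)`. -/
def lowerHausdorffContent (β : ℝ) (E : Set ℂ) : ℝ≥0∞ :=
  ⨆ (h : ℝ≥0 → ℝ≥0) (_ : IsMeasureFunction h) (_ : ∀ t, h t ≤ t ^ β)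
    (_ : Tendsto (fun t => h t / t ^ β) (𝓝[>] 0) (𝓝 0)), hausdorffContent h E

/-- The open unit disk with the closed disks `closedBall (a n) (r n)` removed. -/
def perforatedDisk (a r : ℕ → ℝ) : Set ℂ :=
  ball 0 1 \ ⋃ n, closedBall (a n : ℂ) (r n)

end LipAnalytic

end

open LipAnalytic

/-
By Cauchy's formula on the unit disk with finitely many holes, `f` is a Cauchy transform along the
unit circle minus Cauchy transforms along the boundaries of the holes. Subtracting the constant
`f (a n)` on the boundary of the `n`-th hole changes nothing outside that hole and makes the
integrand at most `‖f‖ * (r n) ^ α` there, so the `n`-th hole enters the Taylor remainder of `f`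
with the weight `(r n) ^ (1 + α) = a n ^ 2 * φ (a n) / n`. If the `a n` decrease fast enough, then
at a point `y` only the one hole with `a n` comparable to `‖y‖` matters, and it contributes
`O(1 / √n) * φ ‖y‖ * ‖y‖` as long as `y` avoids the disk of radius `a n / (2 * √n)` about `a n`.
Since `n → ∞` as `y → 0`, these larger disks have area density `0` at `0`.

On the other hand, the lower content of the `n`-th hole is at least `(r n) ^ (1 + α)`: a gauge that
is a multiple of the area below `r n` gives this by comparing areas. The terms of the second sum
along the sequence `k n` are thus bounded below by a multiple of `1 / n`.
-/

noncomputable section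

namespace LipAnalytic

section CircleCauchy

variable {E : Type*} [NormedAddCommGroup E] [NormedSpace ℂ E] {f g : ℂ → E} {a w x y : ℂ}
  {r M : ℝ}

/-- The Cauchy transform of `f` along the circle with centre `a` and radius `r`. -/
def circleCauchy (f : ℂ → E) (a : ℂ) (r : ℝ) (w : ℂ) : E :=
  (2 * Real.pi * Complex.I : ℂ)⁻¹ • ∮ z in C(a, r), (z - w)⁻¹ • f z

/-- The derivative of the Cauchy transform of `f` along a circle, as an integral. -/
def circleCauchyDeriv (f : ℂ → E) (a : ℂ) (r : ℝ) (w : ℂ) : E :=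
  (2 * Real.pi * Complex.I : ℂ)⁻¹ • ∮ z in C(a, r), (z - w)⁻¹ ^ 2 • f z

theorem sub_ne_zero_of_mem_sphere {z : ℂ} (hw : w ∉ sphere a r) (hz : z ∈ sphere a r) :
    z - w ≠ 0 :=
  sub_ne_zero.2 fun h => hw (h ▸ hz)

theorem abs_dist_sub_pos (hw : w ∉ sphere a r) : 0 < |dist w a - r| :=
  abs_pos.2 (sub_ne_zero.2 hw)

theorem abs_dist_sub_le_norm {z : ℂ} (hz : z ∈ sphere a r) : |dist w a - r| ≤ ‖z - w‖ := by
  rw [← mem_sphere.1 hz, ← dist_eq_norm, dist_comm z w]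
  exact abs_dist_sub_le w z a

theorem norm_inv_sub_le {z : ℂ} (hw : w ∉ sphere a r) (hz : z ∈ sphere a r) :
    ‖(z - w)⁻¹‖ ≤ |dist w a - r|⁻¹ := by
  rw [norm_inv]
  exact inv_anti₀ (abs_dist_sub_pos hw) (abs_dist_sub_le_norm hz)

theorem circleIntegrable_inv_pow_smul (hr : 0 ≤ r) (hf : ContinuousOn f (sphere a r))
    (hw : w ∉ sphere a r) (n : ℕ) : CircleIntegrable (fun z => (z - w)⁻¹ ^ n • f z) a r :=
  ContinuousOn.circleIntegrable hr <| ((ContinuousOn.inv₀ (by fun_prop)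
    fun _ hz => sub_ne_zero_of_mem_sphere hw hz).pow n).smul hf

theorem circleIntegrable_inv_smul (hr : 0 ≤ r) (hf : ContinuousOn f (sphere a r))
    (hw : w ∉ sphere a r) : CircleIntegrable (fun z => (z - w)⁻¹ • f z) a r := by
  simpa only [pow_one] using circleIntegrable_inv_pow_smul hr hf hw 1

theorem circleCauchy_congr (hr : 0 ≤ r) (hfg : EqOn f g (sphere a r)) (w : ℂ) :
    circleCauchy f a r w = circleCauchy g a r w := by
  unfold circleCauchy
  rw [circleIntegral.integral_congr hr fun z hz => by rw [hfg hz]]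

theorem circleCauchy_add (hr : 0 ≤ r) (hf : ContinuousOn f (sphere a r))
    (hg : ContinuousOn g (sphere a r)) (hw : w ∉ sphere a r) :
    circleCauchy (fun z => f z + g z) a r w = circleCauchy f a r w + circleCauchy g a r w := by
  simp only [circleCauchy, smul_add]
  rw [circleIntegral.integral_add (circleIntegrable_inv_smul hr hf hw)
    (circleIntegrable_inv_smul hr hg hw), smul_add]

theorem norm_circleCauchy_le (hr : 0 ≤ r) (hM : ∀ z ∈ sphere a r, ‖f z‖ ≤ M)
    (hw : w ∉ sphere a r) : ‖circleCauchy f a r w‖ ≤ r * (|dist w a - r|⁻¹ * M) := by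
  refine circleIntegral.norm_two_pi_i_inv_smul_integral_le_of_norm_le_const hr fun z hz => ?_
  rw [norm_smul]
  exact mul_le_mul (norm_inv_sub_le hw hz) (hM z hz) (norm_nonneg _) (by positivity)

theorem circleCauchy_taylor_remainder (hr : 0 ≤ r) (hf : ContinuousOn f (sphere a r))
    (hx : x ∉ sphere a r) (hy : y ∉ sphere a r) :
    circleCauchy f a r y - circleCauchy f a r x - (y - x) • circleCauchyDeriv f a r x =
      (2 * Real.pi * Complex.I : ℂ)⁻¹ •
        ∮ z in C(a, r), ((y - x) ^ 2 * (z - x)⁻¹ ^ 2 * (z - y)⁻¹) • f z := by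
  have hker : ∀ z ∈ sphere a r, (z - y)⁻¹ • f z - (z - x)⁻¹ • f z - (y - x) • (z - x)⁻¹ ^ 2 • f z =
      ((y - x) ^ 2 * (z - x)⁻¹ ^ 2 * (z - y)⁻¹) • f z := fun z hz => by
    have hzx := sub_ne_zero_of_mem_sphere hx hz
    have hzy := sub_ne_zero_of_mem_sphere hy hz
    rw [smul_smul, ← sub_smul, ← sub_smul]
    congr 1
    field_simp
    ring
  have hIx := circleIntegrable_inv_smul hr hf hx
  have hIy := circleIntegrable_inv_smul hr hf hy
  have hIx' : CircleIntegrable (fun z => (y - x) • (z - x)⁻¹ ^ 2 • f z) a r :=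
    IntervalIntegrable.smul (circleIntegrable_inv_pow_smul hr hf hx 2) (y - x)
  have hIxy : CircleIntegrable (fun z => (z - y)⁻¹ • f z - (z - x)⁻¹ • f z) a r := hIy.sub hIx
  unfold circleCauchy circleCauchyDeriv
  rw [← circleIntegral.integral_congr hr hker, circleIntegral.integral_sub hIxy hIx',
    circleIntegral.integral_sub hIy hIx, circleIntegral.integral_smul, smul_sub, smul_sub,
    smul_comm (y - x)]

theorem norm_circleCauchy_taylor_le (hr : 0 ≤ r) (hf : ContinuousOn f (sphere a r))
    (hM : ∀ z ∈ sphere a r, ‖f z‖ ≤ M) (hx : x ∉ sphere a r) (hy : y ∉ sphere a r) :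
    ‖circleCauchy f a r y - circleCauchy f a r x - (y - x) • circleCauchyDeriv f a r x‖ ≤
      r * (‖y - x‖ ^ 2 * |dist x a - r|⁻¹ ^ 2 * |dist y a - r|⁻¹ * M) := by
  rw [circleCauchy_taylor_remainder hr hf hx hy]
  refine circleIntegral.norm_two_pi_i_inv_smul_integral_le_of_norm_le_const hr fun z hz => ?_
  rw [norm_smul, norm_mul, norm_mul, norm_pow, norm_pow]
  have := norm_inv_sub_le hx hz
  have := norm_inv_sub_le hy hz
  gcongr
  exact hM z hz

theorem hasDerivAt_circleCauchy (hr : 0 ≤ r) (hf : ContinuousOn f (sphere a r))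
    (hx : x ∉ sphere a r) : HasDerivAt (circleCauchy f a r) (circleCauchyDeriv f a r x) x := by
  obtain ⟨M, hM⟩ := (isCompact_sphere a r).exists_bound_of_continuousOn hf
  rw [hasDerivAt_iff_tendsto]
  have hlim : Tendsto (fun y => r * (‖y - x‖ * |dist x a - r|⁻¹ ^ 2 * |dist y a - r|⁻¹ * M))
      (𝓝 x) (𝓝 0) := by
    have hcont : ContinuousAt
        (fun y => r * (‖y - x‖ * |dist x a - r|⁻¹ ^ 2 * |dist y a - r|⁻¹ * M)) x := by
      have := (abs_dist_sub_pos hx).ne'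
      fun_prop (disch := assumption)
    simpa using hcont.tendsto
  refine squeeze_zero' (Eventually.of_forall fun y => by positivity) ?_ hlim
  filter_upwards [isClosed_sphere.isOpen_compl.mem_nhds hx] with y hy
  rcases eq_or_ne y x with rfl | hyx
  · simp
  have hpos : 0 < ‖y - x‖ := norm_pos_iff.2 (sub_ne_zero.2 hyx)
  rw [inv_mul_le_iff₀ hpos]
  exact (norm_circleCauchy_taylor_le hr hf hM hx hy).trans_eq (by ring)

theorem continuousOn_circleCauchy (hr : 0 ≤ r) (hf : ContinuousOn f (sphere a r)) :
    ContinuousOn (circleCauchy f a r) (sphere a r)ᶜ := fun _ hx =>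
  (hasDerivAt_circleCauchy hr hf hx).continuousAt.continuousWithinAt

theorem circleCauchy_eq_zero (hr : 0 < r) (hf : DiffContOnCl ℂ f (ball a r))
    (hw : w ∉ closedBall a r) : circleCauchy f a r w = 0 := by
  have hne : ∀ z ∈ closure (ball a r), z - w ≠ 0 := fun z hz =>
    sub_ne_zero.2 fun h => hw (h ▸ closure_ball_subset_closedBall hz)
  have hker : DiffContOnCl ℂ (fun z => (z - w)⁻¹) (ball a r) :=
    (Differentiable.diffContOnCl (by fun_prop)).inv hne
  rw [circleCauchy, (hker.smul hf).circleIntegral_eq_zero hr.le, smul_zero]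

theorem circleCauchy_eq_self [CompleteSpace E] (hf : DiffContOnCl ℂ f (ball a r))
    (hw : w ∈ ball a r) : circleCauchy f a r w = f w :=
  hf.two_pi_i_inv_smul_circleIntegral_sub_inv_smul hw

end CircleCauchy

section Annulus

open Bornology

variable {E : Type*} [NormedAddCommGroup E] [NormedSpace ℂ E] {f g : ℂ → E} {a c w : ℂ}
  {r R : ℝ}

theorem tendsto_circleCauchy_cobounded (hr : 0 ≤ r) (hf : ContinuousOn f (sphere a r)) :
    Tendsto (circleCauchy f a r) (cobounded ℂ) (𝓝 0) := by
  obtain ⟨M, hM⟩ := (isCompact_sphere a r).exists_bound_of_continuousOn hf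
  have hdist : Tendsto (fun w => dist w a - r) (cobounded ℂ) atTop :=
    tendsto_atTop_add_const_right _ _ (tendsto_dist_right_cobounded_atTop a)
  refine squeeze_zero_norm' (a := fun w => r * (|dist w a - r|⁻¹ * M)) ?_ ?_
  · filter_upwards [isBounded_def.1 isBounded_sphere] with w hw
    exact norm_circleCauchy_le hr hM hw
  · simpa using (((tendsto_inv_atTop_zero.comp
      (tendsto_abs_atTop_atTop.comp hdist)).mul_const M).const_mul r)

theorem circleCauchy_eq_zero_of_tendsto (hR : 0 < R) (hc : ContinuousOn g (ball c R)ᶜ)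
    (hd : ∀ z ∉ closedBall c R, DifferentiableAt ℂ g z) (hlim : Tendsto g (cobounded ℂ) (𝓝 0))
    (hw : w ∈ ball c R) : circleCauchy g c R w = 0 := by
  refine norm_le_zero_iff.1 (le_of_forall_pos_le_add fun ε hε => ?_)
  have hsmall : ∀ᶠ z in cobounded ℂ, ‖g z‖ ≤ ε / 2 :=
    hlim.norm.eventually (ge_mem_nhds (by simpa using half_pos hε))
  obtain ⟨S, -, hS⟩ := (hasBasis_cobounded_compl_closedBall c).eventually_iff.1 hsmall
  obtain ⟨ρ, hRρ, hSρ, hwρ⟩ : ∃ ρ, R ≤ ρ ∧ S < ρ ∧ 2 * dist w c ≤ ρ :=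
    ⟨max (max R (S + 1)) (2 * dist w c), by simp, by simp, by simp⟩
  have hρ : 0 < ρ := hR.trans_le hRρ
  have hne : ∀ z ∈ closedBall c ρ \ ball c R, z - w ≠ 0 := fun z hz =>
    sub_ne_zero.2 fun h => hz.2 (h ▸ hw)
  have hdeform : circleCauchy g c R w = circleCauchy g c ρ w := by
    unfold circleCauchy
    rw [Complex.circleIntegral_eq_of_differentiable_on_annulus_off_countable hR hRρ
      countable_empty (f := fun z => (z - w)⁻¹ • g z)
      ((ContinuousOn.inv₀ (by fun_prop) hne).smul (hc.mono fun z hz => hz.2)) fun z hz => ?_]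
    exact ((differentiableAt_id.sub_const w).inv (hne z (sdiff_subset_sdiff ball_subset_closedBall
      ball_subset_closedBall hz.1))).smul (hd z hz.1.2)
  have hgap : ρ / 2 ≤ |dist w c - ρ| := by
    rw [abs_sub_comm]
    exact (by linarith : ρ / 2 ≤ ρ - dist w c).trans (le_abs_self _)
  calc ‖circleCauchy g c R w‖ ≤ ρ * (|dist w c - ρ|⁻¹ * (ε / 2)) := by
        rw [hdeform]
        refine norm_circleCauchy_le hρ.le (fun z hz => hS ?_) fun h => ?_
        · simpa [mem_sphere.1 hz] using hSρ
        · linarith [mem_sphere.1 h]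
    _ ≤ ρ * ((ρ / 2)⁻¹ * (ε / 2)) := by gcongr
    _ = 0 + ε := by field_simp; ring

theorem circleCauchy_add_circleCauchy_of_disjoint {b : ℂ} {ρ : ℝ} (hr : 0 ≤ r) (hρ : 0 < ρ)
    (hg : ContinuousOn g (sphere a r)) (hf : ContinuousOn f (sphere b ρ))
    (hdisj : Disjoint (closedBall a r) (closedBall b ρ)) (hw : w ∉ closedBall b ρ) :
    circleCauchy (fun z => f z + circleCauchy g a r z) b ρ w = circleCauchy f b ρ w := by
  have hb : closedBall b ρ ⊆ (sphere a r)ᶜ := fun z hz hza =>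
    disjoint_left.1 hdisj (sphere_subset_closedBall hza) hz
  have hd : DifferentiableOn ℂ (circleCauchy g a r) (closedBall b ρ) := fun z hz =>
    (hasDerivAt_circleCauchy hr hg (hb hz)).differentiableAt.differentiableWithinAt
  rw [circleCauchy_add hρ.le hf (hd.continuousOn.mono sphere_subset_closedBall)
      (mt (sphere_subset_closedBall ·) hw),
    circleCauchy_eq_zero hρ (hd.mono closure_ball_subset_closedBall).diffContOnCl hw, add_zero]

theorem circleCauchy_add_circleCauchy_of_subset (hr : 0 ≤ r)
    (hg : ContinuousOn g (sphere a r)) (hf : ContinuousOn f (sphere c R))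
    (hsub : closedBall a r ⊆ ball c R) (hw : w ∈ ball c R) :
    circleCauchy (fun z => f z + circleCauchy g a r z) c R w = circleCauchy f c R w := by
  have hR : 0 < R := pos_of_mem_ball hw
  have ha : (ball c R)ᶜ ⊆ (sphere a r)ᶜ :=
    compl_subset_compl.2 (sphere_subset_closedBall.trans hsub)
  have hc := (continuousOn_circleCauchy hr hg).mono ha
  rw [circleCauchy_add hR.le hf (hc.mono fun z hz => (mem_sphere.1 hz).not_lt) hw.ne,
    circleCauchy_eq_zero_of_tendsto hR hc (fun z hz => (hasDerivAt_circleCauchy hr hg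
      (ha (mt (ball_subset_closedBall ·) hz))).differentiableAt)
      (tendsto_circleCauchy_cobounded hr hg) hw, add_zero]

theorem circleCauchy_sub_const {b : E} (hr : 0 < r) (hf : ContinuousOn f (sphere a r))
    (hw : w ∉ closedBall a r) : circleCauchy (fun z => f z - b) a r w = circleCauchy f a r w := by
  simp only [sub_eq_add_neg]
  rw [circleCauchy_add hr.le hf continuousOn_const (mt (sphere_subset_closedBall ·) hw),
    circleCauchy_eq_zero hr diffContOnCl_const hw, add_zero]

theorem circleIntegral_dslope (hr : 0 ≤ r) (hf : ContinuousOn f (sphere a r))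
    (hw : w ∉ sphere a r) :
    (2 * Real.pi * Complex.I : ℂ)⁻¹ • ∮ z in C(a, r), dslope f w z =
      circleCauchy f a r w - circleCauchy (fun _ => f w) a r w := by
  have hslope : EqOn (dslope f w) (fun z => (z - w)⁻¹ • f z - (z - w)⁻¹ • f w) (sphere a r) :=
    fun z hz => by
      rw [dslope_of_ne _ (sub_ne_zero.1 (sub_ne_zero_of_mem_sphere hw hz)), slope_def_module,
        smul_sub]
  rw [circleIntegral.integral_congr hr hslope, circleIntegral.integral_sub
    (circleIntegrable_inv_smul hr hf hw) (circleIntegrable_inv_smul hr continuousOn_const hw),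
    smul_sub, circleCauchy, circleCauchy]

theorem circleCauchy_annulus [CompleteSpace E] (hr : 0 < r)
    (hc : ContinuousOn f (closedBall a R \ ball a r))
    (hd : ∀ z ∈ ball a R \ closedBall a r, DifferentiableAt ℂ f z)
    (hw : w ∈ ball a R \ closedBall a r) :
    circleCauchy f a R w = f w + circleCauchy f a r w := by
  have hrw : r < dist w a := not_le.1 hw.2
  have hwR : dist w a < R := hw.1
  have hrR := hrw.trans hwR
  have hR : 0 < R := hr.trans hrR
  have hsphere : ∀ ρ ∈ Icc r R, sphere a ρ ⊆ closedBall a R \ ball a r := fun ρ hρ z hz =>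
    ⟨(mem_sphere.1 hz).trans_le hρ.2, fun h => (mem_sphere.1 hz ▸ hρ.1).not_gt h⟩
  have hmem : closedBall a R \ ball a r ∈ 𝓝 w :=
    mem_of_superset ((isOpen_ball.sdiff isClosed_closedBall).mem_nhds hw)
      (sdiff_subset_sdiff ball_subset_closedBall ball_subset_closedBall)
  have hslope := Complex.circleIntegral_eq_of_differentiable_on_annulus_off_countable hr hrR.le
    (f := dslope f w) (countable_singleton w) ((continuousOn_dslope hmem).2 ⟨hc, hd w hw⟩)
    fun z hz => (differentiableAt_dslope_of_ne hz.2).2 (hd z hz.1)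
  have houter := circleIntegral_dslope hR.le (hc.mono (hsphere R ⟨hrR.le, le_rfl⟩))
    (w := w) hwR.ne
  have hinner := circleIntegral_dslope hr.le (hc.mono (hsphere r ⟨le_rfl, hrR.le⟩))
    (w := w) hrw.ne'
  rw [circleCauchy_eq_self diffContOnCl_const hw.1] at houter
  rw [circleCauchy_eq_zero hr diffContOnCl_const hw.2, sub_zero, ← hslope, houter] at hinner
  rw [← hinner, add_sub_cancel]

theorem exists_extension_of_annulus [CompleteSpace E] (hr : 0 < r) (hrR : r < R)
    (hc : ContinuousOn f (closedBall a R \ ball a r))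
    (hd : ∀ z ∈ ball a R \ closedBall a r, DifferentiableAt ℂ f z) :
    ∃ F : ℂ → E, (∀ w ∈ closedBall a r, DifferentiableAt ℂ F w) ∧
      ∀ w ∉ closedBall a r, F w = f w + circleCauchy f a r w := by
  classical
  let F w := if w ∈ closedBall a r then circleCauchy f a R w else f w + circleCauchy f a r w
  have hF : EqOn F (circleCauchy f a R) (ball a R) := fun w hwR => by
    by_cases hw : w ∈ closedBall a r
    · exact if_pos hw
    · rw [circleCauchy_annulus hr hc hd ⟨hwR, hw⟩]
      exact if_neg hw
  have hsphere : sphere a R ⊆ closedBall a R \ ball a r := fun z hz =>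
    ⟨(mem_sphere.1 hz).le, fun h => (mem_sphere.1 hz ▸ hrR).not_gt h⟩
  refine ⟨F, fun w hw => ?_, fun w hw => if_neg hw⟩
  have hwR : w ∈ ball a R := closedBall_subset_ball hrR hw
  exact (hasDerivAt_circleCauchy (hr.trans hrR).le (hc.mono hsphere)
    hwR.ne).differentiableAt.congr_of_eventuallyEq (hF.eventuallyEq_of_mem
      (isOpen_ball.mem_nhds hwR))

theorem exists_fill_hole [CompleteSpace E] {V K : Set ℂ} (hr : 0 < r) (hV : IsOpen V)
    (haV : closedBall a r ⊆ V) (hVK : V ⊆ K) (hc : ContinuousOn f (K \ ball a r))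
    (hd : DifferentiableOn ℂ f (V \ closedBall a r)) :
    ∃ F : ℂ → E, ContinuousOn F K ∧ DifferentiableOn ℂ F V ∧
      ∀ w ∉ closedBall a r, F w = f w + circleCauchy f a r w := by
  obtain ⟨δ, hδ, hδV⟩ := (isCompact_closedBall a r).exists_cthickening_subset_open hV haV
  rw [cthickening_closedBall hδ.le hr.le] at hδV
  have hdAt : ∀ z ∈ V \ closedBall a r, DifferentiableAt ℂ f z := fun z hz =>
    hd.differentiableAt ((hV.sdiff isClosed_closedBall).mem_nhds hz)
  obtain ⟨F, hFin, hFout⟩ := exists_extension_of_annulus hr (lt_add_of_pos_left r hδ)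
    (hc.mono (sdiff_subset_sdiff_left (hδV.trans hVK)))
    fun z hz => hdAt z (sdiff_subset_sdiff_left (ball_subset_closedBall.trans hδV) hz)
  have hcs : ContinuousOn f (sphere a r) := hc.mono fun z hz =>
    ⟨hVK (haV (sphere_subset_closedBall hz)), (mem_sphere.1 hz).not_lt⟩
  have hCauchy : ∀ z ∉ closedBall a r, DifferentiableAt ℂ (circleCauchy f a r) z := fun z hz =>
    (hasDerivAt_circleCauchy hr.le hcs (mt (sphere_subset_closedBall ·) hz)).differentiableAt
  have hnhds : ∀ z ∉ closedBall a r, (closedBall a r)ᶜ ∈ 𝓝 z := fun z hz =>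
    isClosed_closedBall.isOpen_compl.mem_nhds hz
  have hFev : ∀ z ∉ closedBall a r, F =ᶠ[𝓝 z] fun w => f w + circleCauchy f a r w :=
    fun z hz => mem_of_superset (hnhds z hz) hFout
  refine ⟨F, fun z hz => ?_, fun z hz => DifferentiableAt.differentiableWithinAt ?_, hFout⟩ <;>
    by_cases hza : z ∈ closedBall a r
  · exact (hFin z hza).continuousAt.continuousWithinAt
  · have hmem : K \ ball a r ∈ 𝓝[K] z := mem_of_superset (inter_mem_nhdsWithin K (hnhds z hza))
      (sdiff_subset_sdiff_right ball_subset_closedBall)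
    exact (((hc z ⟨hz, mt (ball_subset_closedBall ·) hza⟩).mono_of_mem_nhdsWithin hmem).add
      (hCauchy z hza).continuousAt.continuousWithinAt).congr_of_eventuallyEq
        ((hFev z hza).filter_mono nhdsWithin_le_nhds) (hFout z hza)
  · exact hFin z hza
  · exact ((hdAt z ⟨hz, hza⟩).add (hCauchy z hza)).congr_of_eventuallyEq (hFev z hza)

end Annulus

section PerforatedDisk

variable {ι E : Type*} [NormedAddCommGroup E] [NormedSpace ℂ E] {f : ℂ → E} {s : Finset ι}
  {a : ι → ℂ} {r : ι → ℝ} {c w x y : ℂ} {R : ℝ} {i : ι}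

/-- The closed disks `closedBall (a i) (r i)`, `i ∈ s`, are holes of `ball c R`: they are
nondegenerate, pairwise disjoint and contained in that open disk. -/
structure IsHoleFamily (s : Finset ι) (a : ι → ℂ) (r : ι → ℝ) (c : ℂ) (R : ℝ) : Prop where
  radius_pos : ∀ i ∈ s, 0 < r i
  subset_ball : ∀ i ∈ s, closedBall (a i) (r i) ⊆ ball c R
  pairwiseDisjoint : (s : Set ι).PairwiseDisjoint fun i => closedBall (a i) (r i)

theorem isOpen_ball_sdiff_holes (s : Finset ι) (a : ι → ℂ) (r : ι → ℝ) (c : ℂ) (R : ℝ) :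
    IsOpen (ball c R \ ⋃ i ∈ s, closedBall (a i) (r i)) :=
  isOpen_ball.sdiff (isClosed_biUnion_finset fun _ _ => isClosed_closedBall)

namespace IsHoleFamily

theorem mono (h : IsHoleFamily s a r c R) {t : Finset ι} (hts : t ⊆ s) :
    IsHoleFamily t a r c R where
  radius_pos i hi := h.radius_pos i (hts hi)
  subset_ball i hi := h.subset_ball i (hts hi)
  pairwiseDisjoint := h.pairwiseDisjoint.subset (Finset.coe_subset.2 hts)

theorem sphere_subset (h : IsHoleFamily s a r c R) (hi : i ∈ s) :
    sphere (a i) (r i) ⊆ closedBall c R \ ⋃ j ∈ s, ball (a j) (r j) := fun z hz => by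
  have hzi : z ∈ closedBall (a i) (r i) := sphere_subset_closedBall hz
  refine ⟨ball_subset_closedBall (h.subset_ball i hi hzi), fun hzs => ?_⟩
  obtain ⟨j, hj, hzj⟩ := mem_iUnion₂.1 hzs
  rcases eq_or_ne i j with rfl | hij
  · exact (mem_sphere.1 hz).not_lt hzj
  · exact disjoint_left.1 (h.pairwiseDisjoint hi hj hij) hzi (ball_subset_closedBall hzj)

theorem outer_sphere_subset (h : IsHoleFamily s a r c R) :
    sphere c R ⊆ closedBall c R \ ⋃ j ∈ s, ball (a j) (r j) := fun z hz => by
  refine ⟨sphere_subset_closedBall hz, fun hzs => ?_⟩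
  obtain ⟨j, hj, hzj⟩ := mem_iUnion₂.1 hzs
  exact (mem_sphere.1 hz).not_lt (h.subset_ball j hj (ball_subset_closedBall hzj))

variable [CompleteSpace E]

theorem circleCauchy_eq_add_sum (h : IsHoleFamily s a r c R)
    (hc : ContinuousOn f (closedBall c R \ ⋃ i ∈ s, ball (a i) (r i)))
    (hd : DifferentiableOn ℂ f (ball c R \ ⋃ i ∈ s, closedBall (a i) (r i)))
    (hw : w ∈ ball c R \ ⋃ i ∈ s, closedBall (a i) (r i)) :
    circleCauchy f c R w = f w + ∑ i ∈ s, circleCauchy f (a i) (r i) w := by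
  classical
  have hR : 0 < R := pos_of_mem_ball hw.1
  induction s using Finset.induction_on generalizing f with
  | empty =>
    simp only [Finset.notMem_empty, iUnion_of_empty, iUnion_empty, sdiff_empty] at hc hd
    rw [circleCauchy_eq_self ⟨hd, by rwa [closure_ball c hR.ne']⟩ hw.1, Finset.sum_empty, add_zero]
  | insert i s his ih =>
    have hi := Finset.mem_insert_self i s
    have hri := h.radius_pos i hi
    have hs := h.mono (Finset.subset_insert i s)
    have hdisj : ∀ j ∈ s, Disjoint (closedBall (a i) (r i)) (closedBall (a j) (r j)) :=
      fun j hj => h.pairwiseDisjoint hi (Finset.mem_insert_of_mem hj)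
        (ne_of_mem_of_not_mem hj his).symm
    have hcR := hc.mono h.outer_sphere_subset
    have hcs := fun j hj => hc.mono (h.sphere_subset (i := j) hj)
    rw [Finset.set_biUnion_insert, union_comm, ← sdiff_sdiff] at hc hd hw
    obtain ⟨F, hFc, hFd, hF⟩ := exists_fill_hole hri (isOpen_ball_sdiff_holes s a r c R)
      (subset_sdiff.2 ⟨h.subset_ball i hi, disjoint_iUnion₂_right.2 hdisj⟩)
      (sdiff_subset_sdiff ball_subset_closedBall
        (iUnion₂_mono fun _ _ => ball_subset_closedBall)) hc hd
    have houter : circleCauchy F c R w = circleCauchy f c R w := by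
      rw [circleCauchy_congr hR.le fun z hz => hF z fun hzi =>
          (mem_sphere.1 hz).not_lt (h.subset_ball i hi hzi),
        circleCauchy_add_circleCauchy_of_subset hri.le (hcs i hi) hcR (h.subset_ball i hi) hw.1.1]
    have hinner : ∀ j ∈ s, circleCauchy F (a j) (r j) w = circleCauchy f (a j) (r j) w := by
      intro j hj
      have hrj := hs.radius_pos j hj
      rw [circleCauchy_congr hrj.le fun z hz => hF z fun hzi =>
          disjoint_left.1 (hdisj j hj) hzi (sphere_subset_closedBall hz),
        circleCauchy_add_circleCauchy_of_disjoint hri.le hrj (hcs i hi)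
          (hcs j (Finset.mem_insert_of_mem hj)) (hdisj j hj)
          fun hwj => hw.1.2 (mem_iUnion₂_of_mem hj hwj)]
    rw [Finset.sum_insert his, ← houter, ih hs hFc hFd hw.1, hF w hw.2, add_assoc,
      Finset.sum_congr rfl hinner]

theorem eq_circleCauchy_sub_sum (h : IsHoleFamily s a r c R) (b : ι → E)
    (hc : ContinuousOn f (closedBall c R \ ⋃ i ∈ s, ball (a i) (r i)))
    (hd : DifferentiableOn ℂ f (ball c R \ ⋃ i ∈ s, closedBall (a i) (r i)))
    (hw : w ∈ ball c R \ ⋃ i ∈ s, closedBall (a i) (r i)) :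
    f w = circleCauchy f c R w - ∑ i ∈ s, circleCauchy (fun z => f z - b i) (a i) (r i) w := by
  rw [h.circleCauchy_eq_add_sum hc hd hw, eq_sub_iff_add_eq, Finset.sum_congr rfl fun i hi =>
    circleCauchy_sub_const (h.radius_pos i hi) (hc.mono (h.sphere_subset hi))
      fun hwi => hw.2 (mem_iUnion₂_of_mem hi hwi)]

theorem norm_taylor_le (h : IsHoleFamily s a r c R) {b : ι → E} {B : ℝ} {M : ι → ℝ}
    (hc : ContinuousOn f (closedBall c R \ ⋃ i ∈ s, ball (a i) (r i)))
    (hd : DifferentiableOn ℂ f (ball c R \ ⋃ i ∈ s, closedBall (a i) (r i)))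
    (hB : ∀ z ∈ sphere c R, ‖f z‖ ≤ B)
    (hM : ∀ i ∈ s, ∀ z ∈ sphere (a i) (r i), ‖f z - b i‖ ≤ M i)
    (hx : x ∈ ball c R \ ⋃ i ∈ s, closedBall (a i) (r i))
    (hy : y ∈ ball c R \ ⋃ i ∈ s, closedBall (a i) (r i)) :
    ‖f y - f x - (y - x) • deriv f x‖ ≤
      R * (‖y - x‖ ^ 2 * |dist x c - R|⁻¹ ^ 2 * |dist y c - R|⁻¹ * B) +
        ∑ i ∈ s, r i *
          (‖y - x‖ ^ 2 * |dist x (a i) - r i|⁻¹ ^ 2 * |dist y (a i) - r i|⁻¹ * M i) := by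
  have hR := (pos_of_mem_ball hx.1).le
  have hcR := hc.mono h.outer_sphere_subset
  have hcs : ∀ i ∈ s, ContinuousOn (fun z => f z - b i) (sphere (a i) (r i)) := fun i hi =>
    (hc.mono (h.sphere_subset hi)).sub continuousOn_const
  have hoff : ∀ w ∈ ball c R \ ⋃ i ∈ s, closedBall (a i) (r i), ∀ i ∈ s,
      w ∉ sphere (a i) (r i) := fun w hw i hi hwi =>
    hw.2 (mem_iUnion₂_of_mem hi (sphere_subset_closedBall hwi))
  have hrep := fun w hw => h.eq_circleCauchy_sub_sum b hc hd (w := w) hw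
  have hderiv : HasDerivAt f (circleCauchyDeriv f c R x -
      ∑ i ∈ s, circleCauchyDeriv (fun z => f z - b i) (a i) (r i) x) x := by
    refine ((hasDerivAt_circleCauchy hR hcR hx.1.ne).sub (HasDerivAt.fun_sum fun i hi =>
      hasDerivAt_circleCauchy (h.radius_pos i hi).le (hcs i hi)
        (hoff x hx i hi))).congr_of_eventuallyEq ?_
    exact mem_of_superset ((isOpen_ball_sdiff_holes s a r c R).mem_nhds hx) hrep
  rw [hderiv.deriv, hrep x hx, hrep y hy]
  have hsplit : ∀ p q p' q' d d' : E, p - q - (p' - q') - (y - x) • (d - d') =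
      p - p' - (y - x) • d - (q - q' - (y - x) • d') := fun p q p' q' d d' => by
    rw [smul_sub]
    abel
  rw [hsplit, ← Finset.sum_sub_distrib, Finset.smul_sum, ← Finset.sum_sub_distrib]
  refine (norm_sub_le _ _).trans (add_le_add
    (norm_circleCauchy_taylor_le hR hcR hB hx.1.ne hy.1.ne)
    ((norm_sum_le _ _).trans (Finset.sum_le_sum fun i hi => ?_)))
  exact norm_circleCauchy_taylor_le (h.radius_pos i hi).le (hcs i hi) (hM i hi)
    (hoff x hx i hi) (hoff y hy i hi)

end IsHoleFamily

end PerforatedDisk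

section HausdorffContent

variable {β : ℝ} {r t : ℝ≥0}

theorem square_subset_closedBall (c : ℂ) (u : Circle) (s : ℝ≥0) :
    square c u s ⊆ closedBall c s := by
  rintro _ ⟨z, ⟨hre, him⟩, rfl⟩
  rw [mem_closedBall, dist_eq_norm, add_sub_cancel_left, norm_mul, Circle.norm_coe, one_mul]
  exact (Complex.norm_le_abs_re_add_abs_im z).trans (by linarith)

theorem hausdorffContent_mono (h : ℝ≥0 → ℝ≥0) {E F : Set ℂ} (hEF : E ⊆ F) :
    hausdorffContent h E ≤ hausdorffContent h F :=
  iInf_mono fun _ => iInf_mono fun _ => iInf_mono fun _ => iInf_mono' fun hc =>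
    ⟨hEF.trans hc, le_rfl⟩

theorem lowerHausdorffContent_mono (β : ℝ) {E F : Set ℂ} (hEF : E ⊆ F) :
    lowerHausdorffContent β E ≤ lowerHausdorffContent β F :=
  iSup_mono fun h => iSup_mono fun _ => iSup_mono fun _ => iSup_mono fun _ =>
    hausdorffContent_mono h hEF

theorem sq_le_tsum_of_subset_iUnion_square {c : ℂ} {x : ℕ → ℂ} {u : ℕ → Circle}
    {s : ℕ → ℝ≥0} (h : closedBall c r ⊆ ⋃ j, square (x j) (u j) (s j)) :
    (r : ℝ≥0∞) ^ 2 ≤ ∑' j, (s j : ℝ≥0∞) ^ 2 := by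
  have harea : volume (closedBall c (r : ℝ)) ≤ ∑' j, volume (closedBall (x j) (s j : ℝ)) :=
    (measure_mono (h.trans (iUnion_mono fun j => square_subset_closedBall _ _ _))).trans
      (measure_iUnion_le _)
  simp only [Complex.volume_closedBall, ENNReal.ofReal_coe_nnreal, ENNReal.tsum_mul_right] at harea
  refine (ENNReal.mul_le_mul_iff_left ?_ ENNReal.coe_ne_top).1 harea
  simpa using NNReal.pi_pos.ne'

/-- For `0 < β < 2`, a measure function that is `o(t ^ β)` at `0` and equals `t ^ β` at `t = r`;
since it is quadratic for `t ≤ r`, there the content can be estimated by area. -/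
def areaGauge (β : ℝ) (r t : ℝ≥0) : ℝ≥0 :=
  min (t ^ β) (r ^ (β - 2) * t ^ 2)

theorem areaGauge_of_le (hβ2 : β ≤ 2) (ht : t ≤ r) :
    areaGauge β r t = r ^ (β - 2) * t ^ 2 := by
  refine min_eq_right ?_
  rcases eq_or_ne t 0 with rfl | ht0
  · simp
  calc r ^ (β - 2) * t ^ 2 ≤ t ^ (β - 2) * t ^ 2 := by
        gcongr ?_ * _
        exact NNReal.rpow_le_rpow_of_nonpos (pos_of_ne_zero ht0) ht (by linarith)
    _ = t ^ β := by rw [← NNReal.rpow_add_natCast ht0]; norm_num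

theorem areaGauge_self (hr : 0 < r) : areaGauge β r r = r ^ β := by
  rw [areaGauge, ← NNReal.rpow_add_natCast hr.ne']
  norm_num

theorem monotone_areaGauge (hβ0 : 0 < β) : Monotone (areaGauge β r) := fun s t hst => by
  unfold areaGauge
  gcongr

theorem isMeasureFunction_areaGauge (hβ0 : 0 < β) : IsMeasureFunction (areaGauge β r) := by
  refine ⟨monotone_areaGauge hβ0, ?_⟩
  have hcont : Continuous (areaGauge β r) := by
    have := NNReal.continuous_rpow_const hβ0.le
    unfold areaGauge
    fun_prop
  simpa [areaGauge, NNReal.zero_rpow hβ0.ne'] using hcont.tendsto 0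

theorem tendsto_areaGauge_div_rpow (hβ2 : β < 2) :
    Tendsto (fun t => areaGauge β r t / t ^ β) (𝓝[>] 0) (𝓝 0) := by
  have hlim : Tendsto (fun t : ℝ≥0 => r ^ (β - 2) * t ^ (2 - β)) (𝓝[>] 0) (𝓝 0) := by
    have hcont := (NNReal.continuous_rpow_const (sub_pos.2 hβ2).le).const_mul (r ^ (β - 2))
    simpa [NNReal.zero_rpow (sub_pos.2 hβ2).ne'] using
      (hcont.tendsto 0).mono_left nhdsWithin_le_nhds
  refine tendsto_of_tendsto_of_tendsto_of_le_of_le' tendsto_const_nhds hlim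
    (Eventually.of_forall fun _ => zero_le) ?_
  filter_upwards [self_mem_nhdsWithin] with t ht
  have hsq : t ^ 2 = t ^ (2 - β) * t ^ β := by
    rw [← NNReal.rpow_add (ne_of_gt ht), sub_add_cancel, NNReal.rpow_two]
  rw [div_le_iff₀ (NNReal.rpow_pos ht), mul_assoc, ← hsq]
  exact min_le_right _ _

theorem rpow_le_hausdorffContent_areaGauge (hr : 0 < r) (hβ0 : 0 < β) (hβ2 : β ≤ 2) (c : ℂ) :
    ((r ^ β : ℝ≥0) : ℝ≥0∞) ≤ hausdorffContent (areaGauge β r) (closedBall c r) := by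
  refine le_iInf fun x => le_iInf fun u => le_iInf fun s => le_iInf fun hcov => ?_
  by_cases hlarge : ∃ j, r < s j
  · obtain ⟨j, hj⟩ := hlarge
    rw [← areaGauge_self hr]
    exact (ENNReal.coe_le_coe.2 (monotone_areaGauge hβ0 hj.le)).trans (ENNReal.le_tsum j)
  · push Not at hlarge
    calc ((r ^ β : ℝ≥0) : ℝ≥0∞) = (r ^ (β - 2) : ℝ≥0) * (r : ℝ≥0∞) ^ 2 := by
          rw [← areaGauge_self hr, areaGauge_of_le hβ2 le_rfl]
          push_cast
          rfl
      _ ≤ (r ^ (β - 2) : ℝ≥0) * ∑' j, (s j : ℝ≥0∞) ^ 2 := by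
          gcongr
          exact sq_le_tsum_of_subset_iUnion_square hcov
      _ = ∑' j, (areaGauge β r (s j) : ℝ≥0∞) := by
          rw [← ENNReal.tsum_mul_left]
          refine tsum_congr fun j => ?_
          rw [areaGauge_of_le hβ2 (hlarge j)]
          push_cast
          rfl

theorem rpow_le_lowerHausdorffContent_closedBall (hβ0 : 0 < β) (hβ2 : β < 2) (c : ℂ)
    (hr : 0 < r) : ((r ^ β : ℝ≥0) : ℝ≥0∞) ≤ lowerHausdorffContent β (closedBall c r) :=
  (rpow_le_hausdorffContent_areaGauge hr hβ0 hβ2.le c).trans <|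
    le_iSup₂_of_le (areaGauge β r) (isMeasureFunction_areaGauge hβ0) <|
      le_iSup₂_of_le (fun _ => min_le_left _ _) (tendsto_areaGauge_div_rpow hβ2) le_rfl

end HausdorffContent

section Sparse

variable {φ : ℝ → ℝ} {a : ℕ → ℝ}

theorem IsAdmissible.div_le_div_of_le (hφ : IsAdmissible φ) {s t : ℝ} (hs : 0 < s)
    (hst : s ≤ t) : φ t / t ≤ φ s / s := by
  simpa only [inv_div] using
    inv_anti₀ (hφ.assoc_pos s hs) (hφ.assoc_mono hs (hs.trans_le hst) hst)

theorem IsAdmissible.le_two_mul (hφ : IsAdmissible φ) {s t : ℝ} (hs : 0 < s) (ht : 0 < t)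
    (hts : t ≤ 2 * s) : φ t ≤ 2 * φ s :=
  calc φ t ≤ φ (2 * s) := hφ.mono ht (by positivity : 0 < 2 * s) hts
    _ = 2 * s * (φ (2 * s) / (2 * s)) := by field_simp
    _ ≤ 2 * s * (φ s / s) := mul_le_mul_of_nonneg_left
      (hφ.div_le_div_of_le hs (le_mul_of_one_le_left hs.le one_le_two)) (by positivity)
    _ = 2 * φ s := by field_simp

theorem IsAdmissible.tendsto_div_atTop (hφ : IsAdmissible φ) :
    Tendsto (fun t => φ t / t) (𝓝[>] 0) atTop := by
  have hψ : Tendsto (fun t => t / φ t) (𝓝[>] 0) (𝓝[>] 0) :=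
    tendsto_nhdsWithin_iff.2 ⟨hφ.assoc_tendsto, eventually_mem_nhdsWithin.mono hφ.assoc_pos⟩
  exact hψ.inv_tendsto_nhdsGT_zero.congr fun t => inv_div t (φ t)

/-- The lacunarity of the centres `a n`: both `φ (a n)` and `(φ (a n) / a n)⁻¹` decay at least
geometrically, so that at a point of modulus `t` the centres well outside `t`, whose influence is
governed by `φ (a n) / a n`, and those well inside `t`, governed by `φ (a n)`, sum up like
geometric series. -/
structure IsSparse (φ : ℝ → ℝ) (a : ℕ → ℝ) : Prop where
  pos : ∀ n, 0 < a n
  apply_zero_le : a 0 ≤ 1 / 2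
  phi_zero_le : φ (a 0) ≤ 1 / 16
  succ_le : ∀ n, a (n + 1) ≤ 1 / 4 * a n
  phi_succ_le : ∀ n, φ (a (n + 1)) ≤ 1 / 2 * φ (a n)
  phi_div_le : ∀ n, φ (a n) / a n ≤ 1 / 4 * (φ (a (n + 1)) / a (n + 1))

theorem IsAdmissible.exists_isSparse (hφ : IsAdmissible φ) (hφ0 : Tendsto φ (𝓝[>] 0) (𝓝 0)) :
    ∃ k : ℕ → ℕ, StrictMono k ∧ 1 ≤ k 0 ∧ IsSparse φ fun n => 3 / 4 * ((2 : ℝ) ^ k n)⁻¹ := by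
  set b : ℕ → ℝ := fun k => 3 / 4 * ((2 : ℝ) ^ k)⁻¹ with hb
  have hbpos (k : ℕ) : 0 < b k := by positivity
  have hbanti : Antitone b := fun i j hij => by
    simp only [hb]
    gcongr
    exact one_le_two
  have hb0 : Tendsto b atTop (𝓝[>] 0) := by
    refine tendsto_nhdsWithin_iff.2 ⟨?_, .of_forall hbpos⟩
    simpa only [mul_zero, Function.comp_def] using (tendsto_inv_atTop_zero.comp
      (tendsto_pow_atTop_atTop_of_one_lt (one_lt_two (α := ℝ)))).const_mul (3 / 4)
  have hφb : Tendsto (fun k => φ (b k)) atTop (𝓝 0) := hφ0.comp hb0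
  have hqb : Tendsto (fun k => φ (b k) / b k) atTop atTop := hφ.tendsto_div_atTop.comp hb0
  have hnext (k : ℕ) : ∃ l, k + 2 ≤ l ∧ φ (b l) ≤ 1 / 2 * φ (b k) ∧
      4 * (φ (b k) / b k) ≤ φ (b l) / b l :=
    ((eventually_ge_atTop (k + 2)).and <|
      (hφb.eventually_le_const (mul_pos one_half_pos (hφ.pos _ (hbpos k)))).and <|
        hqb.eventually_ge_atTop (4 * (φ (b k) / b k))).exists
  choose next hgap hφnext hqnext using hnext
  obtain ⟨k₀, hk₀, hφk₀⟩ := ((eventually_ge_atTop 1).and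
    (hφb.eventually_le_const (show (0 : ℝ) < 1 / 16 by norm_num))).exists
  have hsucc (n : ℕ) : next^[n + 1] k₀ = next (next^[n] k₀) := Function.iterate_succ_apply' ..
  refine ⟨fun n => next^[n] k₀, strictMono_nat_of_lt_succ fun n => ?_, hk₀, ?_⟩
  · have := hgap (next^[n] k₀)
    rw [hsucc]
    lia
  change IsSparse φ fun n => b (next^[n] k₀)
  refine ⟨fun n => hbpos _, ?_, hφk₀, fun n => ?_, fun n => ?_, fun n => ?_⟩
  · refine (hbanti hk₀).trans ?_
    norm_num [hb]
  · rw [hsucc]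
    refine (hbanti (hgap _)).trans_eq ?_
    simp only [hb, pow_add]
    ring
  · simpa only [hsucc] using hφnext (next^[n] k₀)
  · simp only [hsucc]
    linarith [hqnext (next^[n] k₀)]

namespace IsSparse

theorem add_le (ha : IsSparse φ a) (m j : ℕ) : a (m + j) ≤ (1 / 4) ^ j * a m :=
  le_geom (u := fun j => a (m + j)) (by norm_num) j fun i _ => ha.succ_le (m + i)

theorem phi_add_le (ha : IsSparse φ a) (m j : ℕ) : φ (a (m + j)) ≤ (1 / 2) ^ j * φ (a m) :=
  le_geom (u := fun j => φ (a (m + j))) (by norm_num) j fun i _ => ha.phi_succ_le (m + i)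

theorem antitone (ha : IsSparse φ a) : Antitone a :=
  antitone_nat_of_succ_le fun n => by linarith [ha.succ_le n, ha.pos n]

theorem four_mul_le (ha : IsSparse φ a) {i j : ℕ} (hij : i < j) : 4 * a j ≤ a i := by
  linarith [ha.antitone (Nat.succ_le_of_lt hij), ha.succ_le i]

theorem exists_lt (ha : IsSparse φ a) {s : ℝ} (hs : 0 < s) : ∃ n, a n < s := by
  obtain ⟨n, hn⟩ := exists_pow_lt_of_lt_one hs (by norm_num : (1 / 4 : ℝ) < 1)
  have hdecay := ha.add_le 0 n
  rw [zero_add] at hdecay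
  refine ⟨n, hdecay.trans_lt <| (mul_le_of_le_one_right (by positivity) ?_).trans_lt hn⟩
  linarith [ha.apply_zero_le]

theorem exists_succ_lt_le (ha : IsSparse φ a) {s : ℝ} {M : ℕ} (hs : 0 < s) (hsM : s ≤ a M) :
    ∃ p ≥ M, s ≤ a p ∧ a (p + 1) < s := by
  classical
  have hex := ha.exists_lt hs
  have hM : M < Nat.find hex :=
    lt_of_not_ge fun h => (hsM.trans (ha.antitone h)).not_gt (Nat.find_spec hex)
  refine ⟨Nat.find hex - 1, by lia, not_lt.1 (Nat.find_min hex (by lia)), ?_⟩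
  rw [Nat.sub_add_cancel (by lia)]
  exact Nat.find_spec hex

theorem norm_coe (ha : IsSparse φ a) (n : ℕ) : ‖(a n : ℂ)‖ = a n :=
  Complex.norm_of_nonneg (ha.pos n).le

end IsSparse

end Sparse

section Interaction

variable {φ : ℝ → ℝ} {a : ℕ → ℝ} {y : ℂ} {p : ℕ}

theorem tendsto_const_div_sqrt (c : ℝ) :
    Tendsto (fun n : ℕ => c / √((n : ℝ) + 1)) atTop (𝓝 0) :=
  tendsto_const_nhds.div_atTop <| Real.tendsto_sqrt_atTop.comp <|
    tendsto_atTop_add_const_right _ _ tendsto_natCast_atTop_atTop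

/-- The set near the centres `a n` that has to be avoided for the Taylor estimate. -/
def exceptionalSet (a : ℕ → ℝ) : Set ℂ :=
  ⋃ n : ℕ, closedBall (a n : ℂ) (a n / (2 * √(n + 1)))

/-- The influence at `y` of the `n`-th hole: up to a factor `‖y‖ ^ 2` and the Hölder constant of
`f`, a bound for the Taylor remainder at `y` of the Cauchy transform of `f` along that hole. -/
def interaction (φ : ℝ → ℝ) (a : ℕ → ℝ) (y : ℂ) (n : ℕ) : ℝ :=
  φ (a n) / ((n + 1) * ‖y - a n‖)

theorem lt_norm_sub_of_notMem_exceptionalSet (hy : y ∉ exceptionalSet a) (n : ℕ) :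
    a n / (2 * √(n + 1)) < ‖y - a n‖ := by
  rw [← dist_eq_norm, ← not_le]
  exact fun h => hy (mem_iUnion_of_mem n h)

namespace IsSparse

theorem interaction_nonneg (ha : IsSparse φ a) (hφ : IsAdmissible φ) (y : ℂ) (n : ℕ) :
    0 ≤ interaction φ a y n := by
  have := hφ.pos _ (ha.pos n)
  unfold interaction
  positivity

theorem sum_phi_div_le (ha : IsSparse φ a) (hφ : IsAdmissible φ) (m : ℕ) :
    ∑ n ∈ Finset.range (m + 1), φ (a n) / a n / (n + 1) ≤ 2 * (φ (a m) / a m) / (m + 1) := by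
  have hpos (n : ℕ) : 0 < φ (a n) / a n := div_pos (hφ.pos _ (ha.pos n)) (ha.pos n)
  induction m with
  | zero => simpa using le_mul_of_one_le_left (hpos 0).le one_le_two
  | succ m ih =>
    rw [Finset.sum_range_succ]
    have hlast : 2 * (φ (a m) / a m) / (m + 1) ≤
        φ (a (m + 1)) / a (m + 1) / ((m + 1 : ℕ) + 1) := by
      have := hpos (m + 1)
      calc 2 * (φ (a m) / a m) / (m + 1)
          ≤ 2 * (1 / 4 * (φ (a (m + 1)) / a (m + 1))) / (m + 1) := by
            gcongr ?_ / _
            linarith [ha.phi_div_le m]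
        _ = φ (a (m + 1)) / a (m + 1) / (2 * (m + 1)) := by rw [← div_div]; ring
        _ ≤ _ := by
          gcongr
          push_cast
          linarith [m.cast_nonneg (α := ℝ)]
    calc _ ≤ φ (a (m + 1)) / a (m + 1) / ((m + 1 : ℕ) + 1) +
          φ (a (m + 1)) / a (m + 1) / ((m + 1 : ℕ) + 1) := by gcongr; exact ih.trans hlast
      _ = _ := by ring

theorem sum_interaction_far_le (ha : IsSparse φ a) (hφ : IsAdmissible φ) (hy0 : y ≠ 0)
    (hyp : 2 * ‖y‖ ≤ a p) :
    ∑ n ∈ Finset.range (p + 1), interaction φ a y n ≤ 4 / (p + 1) * (φ ‖y‖ / ‖y‖) := by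
  have hterm (n : ℕ) (hn : n ∈ Finset.range (p + 1)) :
      interaction φ a y n ≤ 2 * (φ (a n) / a n / (n + 1)) := by
    have hpos := ha.pos n
    have := hφ.pos _ hpos
    have hdist : a n / 2 ≤ ‖y - a n‖ := by
      have := norm_sub_norm_le (a n : ℂ) y
      rw [norm_sub_rev, ha.norm_coe] at this
      linarith [ha.antitone (Finset.mem_range_succ_iff.1 hn)]
    calc interaction φ a y n ≤ φ (a n) / ((n + 1) * (a n / 2)) := by
          unfold interaction
          gcongr
      _ = _ := by field_simp
  have hy : ‖y‖ ≤ a p := by linarith [norm_nonneg y]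
  calc _ ≤ 2 * ∑ n ∈ Finset.range (p + 1), φ (a n) / a n / (n + 1) := by
        rw [Finset.mul_sum]
        exact Finset.sum_le_sum hterm
    _ ≤ 2 * (2 * (φ (a p) / a p) / (p + 1)) := by
      gcongr
      exact ha.sum_phi_div_le hφ p
    _ = 4 / (p + 1) * (φ (a p) / a p) := by ring
    _ ≤ _ := mul_le_mul_of_nonneg_left
      (hφ.div_le_div_of_le (norm_pos_iff.2 hy0) hy) (by positivity)

theorem interaction_resonant_le (ha : IsSparse φ a) (hφ : IsAdmissible φ) (hy0 : y ≠ 0)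
    (hy : y ∉ exceptionalSet a) (hyp : a p < 2 * ‖y‖) :
    interaction φ a y p ≤ 8 / √(p + 1) * (φ ‖y‖ / ‖y‖) := by
  have hynorm : 0 < ‖y‖ := norm_pos_iff.2 hy0
  have hφy := hφ.pos _ hynorm
  have hdist : ‖y‖ / (4 * √(p + 1)) ≤ ‖y - a p‖ := by
    rcases le_or_gt (a p) (‖y‖ / 2) with hap | hap
    · have hsqrt : 1 ≤ √((p : ℝ) + 1) := Real.one_le_sqrt.2 (by simp)
      calc ‖y‖ / (4 * √(p + 1)) ≤ ‖y‖ / 2 := by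
            gcongr
            linarith
        _ ≤ ‖y‖ - ‖(a p : ℂ)‖ := by
          rw [ha.norm_coe]
          linarith
        _ ≤ ‖y - a p‖ := norm_sub_norm_le ..
    · calc ‖y‖ / (4 * √(p + 1)) = ‖y‖ / 2 / (2 * √(p + 1)) := by ring
        _ ≤ a p / (2 * √(p + 1)) := by gcongr
        _ ≤ ‖y - a p‖ := (lt_norm_sub_of_notMem_exceptionalSet hy p).le
  calc interaction φ a y p ≤ 2 * φ ‖y‖ / ((p + 1) * (‖y‖ / (4 * √(p + 1)))) := by
        unfold interaction
        gcongr
        exact hφ.le_two_mul hynorm (ha.pos p) hyp.le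
    _ = 8 * (√(p + 1) / (p + 1)) * (φ ‖y‖ / ‖y‖) := by
      field_simp
      norm_num
    _ = 8 / √(p + 1) * (φ ‖y‖ / ‖y‖) := by rw [Real.sqrt_div_self', mul_one_div]

theorem sum_interaction_near_le (ha : IsSparse φ a) (hφ : IsAdmissible φ) (hy0 : y ≠ 0)
    (hyp : a p < 2 * ‖y‖) (N : ℕ) :
    ∑ j ∈ Finset.range N, interaction φ a y (p + 1 + j) ≤ 4 / (p + 1) * (φ ‖y‖ / ‖y‖) := by
  have hynorm : 0 < ‖y‖ := norm_pos_iff.2 hy0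
  have hφy := hφ.pos _ hynorm
  have hterm (j : ℕ) :
      interaction φ a y (p + 1 + j) ≤ 2 / (p + 1) * (φ ‖y‖ / ‖y‖) * (1 / 2) ^ j := by
    have hdist : ‖y‖ / 2 ≤ ‖y - a (p + 1 + j)‖ := by
      have := norm_sub_norm_le y (a (p + 1 + j) : ℂ)
      rw [ha.norm_coe] at this
      linarith [ha.four_mul_le (show p < p + 1 + j by lia)]
    have hφa : φ (a (p + 1 + j)) ≤ (1 / 2) ^ j * φ ‖y‖ := by
      refine (ha.phi_add_le (p + 1) j).trans ?_
      gcongr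
      linarith [ha.phi_succ_le p, hφ.le_two_mul hynorm (ha.pos p) hyp.le]
    have hindex : (p : ℝ) + 1 ≤ (p + 1 + j : ℕ) + 1 := by
      push_cast
      linarith [j.cast_nonneg (α := ℝ)]
    calc interaction φ a y (p + 1 + j)
        ≤ (1 / 2) ^ j * φ ‖y‖ / ((p + 1) * (‖y‖ / 2)) := by
          unfold interaction
          gcongr
      _ = _ := by field_simp
  calc _ ≤ ∑ j ∈ Finset.range N, 2 / (p + 1) * (φ ‖y‖ / ‖y‖) * (1 / 2 : ℝ) ^ j :=
        Finset.sum_le_sum fun j _ => hterm j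
    _ ≤ 2 / (p + 1) * (φ ‖y‖ / ‖y‖) * 2 := by
      rw [← Finset.mul_sum]
      gcongr
      exact (summable_geometric_two.sum_le_tsum _ fun _ _ => by positivity).trans_eq
        tsum_geometric_two
    _ = _ := by ring

theorem sum_interaction_le_div_sqrt (ha : IsSparse φ a) (hφ : IsAdmissible φ) (hy0 : y ≠ 0)
    (hy : y ∉ exceptionalSet a) (hyp : 2 * ‖y‖ ≤ a p) (hyp' : a (p + 1) < 2 * ‖y‖) (N : ℕ) :
    ∑ n ∈ Finset.range N, interaction φ a y n ≤ 16 / √(p + 1) * (φ ‖y‖ / ‖y‖) := by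
  have hq : 0 < φ ‖y‖ / ‖y‖ := div_pos (hφ.pos _ (norm_pos_iff.2 hy0)) (norm_pos_iff.2 hy0)
  have hsqrt : √((p : ℝ) + 1) ≤ p + 1 := Real.sqrt_le_self_iff.2 (.inr (by simp))
  have hsucc : (p : ℝ) + 1 ≤ (p + 1 : ℕ) + 1 := by simp
  calc ∑ n ∈ Finset.range N, interaction φ a y n
      ≤ ∑ n ∈ Finset.range (p + 1 + 1 + N), interaction φ a y n :=
        Finset.sum_le_sum_of_subset_of_nonneg (Finset.range_mono (by lia))
          fun n _ _ => ha.interaction_nonneg hφ y n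
    _ = ∑ n ∈ Finset.range (p + 1), interaction φ a y n + interaction φ a y (p + 1) +
        ∑ j ∈ Finset.range N, interaction φ a y (p + 1 + 1 + j) := by
      rw [Finset.sum_range_add, Finset.sum_range_succ]
    _ ≤ 4 / (p + 1) * (φ ‖y‖ / ‖y‖) + 8 / √((p + 1 : ℕ) + 1) * (φ ‖y‖ / ‖y‖) +
        4 / ((p + 1 : ℕ) + 1) * (φ ‖y‖ / ‖y‖) := by
      gcongr
      exacts [ha.sum_interaction_far_le hφ hy0 hyp, ha.interaction_resonant_le hφ hy0 hy hyp',
        ha.sum_interaction_near_le hφ hy0 hyp' N]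
    _ ≤ 4 / √(p + 1) * (φ ‖y‖ / ‖y‖) + 8 / √(p + 1) * (φ ‖y‖ / ‖y‖) +
        4 / √(p + 1) * (φ ‖y‖ / ‖y‖) := by
      gcongr
      exact hsqrt.trans hsucc
    _ = 16 / √(p + 1) * (φ ‖y‖ / ‖y‖) := by ring

theorem exists_sum_interaction_le (ha : IsSparse φ a) (hφ : IsAdmissible φ) {ε : ℝ} (hε : 0 < ε) :
    ∃ R > 0, ∀ y : ℂ, y ≠ 0 → ‖y‖ < R → y ∉ exceptionalSet a →
      ∀ N : ℕ, ∑ n ∈ Finset.range N, interaction φ a y n ≤ ε * (φ ‖y‖ / ‖y‖) := by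
  obtain ⟨M, hM⟩ := ((tendsto_const_div_sqrt 16).eventually_le_const hε).exists
  refine ⟨a M / 2, half_pos (ha.pos M), fun y hy0 hyM hy N => ?_⟩
  have hynorm : 0 < ‖y‖ := norm_pos_iff.2 hy0
  have hφy := hφ.pos _ hynorm
  obtain ⟨p, hMp, hyp, hyp'⟩ :=
    ha.exists_succ_lt_le (s := 2 * ‖y‖) (M := M) (by positivity) (by linarith)
  refine (ha.sum_interaction_le_div_sqrt hφ hy0 hy hyp hyp' N).trans ?_
  gcongr
  refine le_trans ?_ hM
  gcongr

end IsSparse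

end Interaction

section Density

variable {φ : ℝ → ℝ} {a : ℕ → ℝ}

theorem volume_iUnion_closedBall_le {c : ℕ → ℂ} {r : ℕ → ℝ} {R : ℝ}
    (hr : ∀ j, r j ≤ (1 / 2) ^ j * R) :
    volume (⋃ j, closedBall (c j) (r j)) ≤ 2 * volume (ball (0 : ℂ) R) := by
  have hterm (j : ℕ) : volume (closedBall (c j) (r j)) ≤ 2⁻¹ ^ j * volume (ball (0 : ℂ) R) := by
    have hrj : ENNReal.ofReal (r j) ≤ 2⁻¹ ^ j * ENNReal.ofReal R := by
      refine (ENNReal.ofReal_le_ofReal (hr j)).trans_eq ?_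
      rw [ENNReal.ofReal_mul (by positivity), ENNReal.ofReal_pow (by positivity), one_div,
        ENNReal.ofReal_inv_of_pos two_pos, ENNReal.ofReal_ofNat]
    have hsq : ((2⁻¹ : ℝ≥0∞) ^ j) ^ 2 ≤ 2⁻¹ ^ j :=
      pow_le_of_le_one zero_le (pow_le_one₀ zero_le (by norm_num)) two_ne_zero
    rw [Complex.volume_closedBall, Complex.volume_ball, ← mul_assoc]
    gcongr
    calc ENNReal.ofReal (r j) ^ 2 ≤ (2⁻¹ ^ j * ENNReal.ofReal R) ^ 2 := by gcongr
      _ ≤ 2⁻¹ ^ j * ENNReal.ofReal R ^ 2 := by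
        rw [mul_pow]
        gcongr
  calc volume (⋃ j, closedBall (c j) (r j))
      ≤ ∑' j : ℕ, 2⁻¹ ^ j * volume (ball (0 : ℂ) R) :=
        (measure_iUnion_le _).trans (ENNReal.tsum_le_tsum hterm)
    _ = 2 * volume (ball (0 : ℂ) R) := by
      rw [ENNReal.tsum_mul_right, ENNReal.tsum_geometric, ENNReal.one_sub_inv_two, inv_inv]

namespace IsSparse

theorem half_le_norm_of_mem_closedBall (ha : IsSparse φ a) {n : ℕ} {z : ℂ}
    (hz : z ∈ closedBall (a n : ℂ) (a n / (2 * √(n + 1)))) : a n / 2 ≤ ‖z‖ := by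
  have hsqrt : 1 ≤ √((n : ℝ) + 1) := Real.one_le_sqrt.2 (by simp)
  have hpos := ha.pos n
  have hdist : ‖(a n : ℂ)‖ - ‖z‖ ≤ a n / 2 := calc
    ‖(a n : ℂ)‖ - ‖z‖ ≤ ‖(a n : ℂ) - z‖ := norm_sub_norm_le ..
    _ ≤ a n / (2 * √(n + 1)) := by rwa [← dist_eq_norm, ← mem_closedBall']
    _ ≤ a n / 2 := by
      gcongr
      linarith
  rw [ha.norm_coe] at hdist
  linarith

theorem ball_inter_exceptionalSet_subset (ha : IsSparse φ a) {M p : ℕ} {t : ℝ} (hMp : M ≤ p)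
    (hp : 2 * t ≤ a p) (hp' : a (p + 1) < 2 * t) :
    ball 0 t ∩ exceptionalSet a ⊆
      ⋃ j : ℕ, closedBall (a (p + 1 + j) : ℂ) ((1 / 2) ^ j * (t / √(M + 1))) := by
  rintro z ⟨hzt, hz⟩
  obtain ⟨n, hn⟩ := mem_iUnion.1 hz
  have hpn : p < n := by
    by_contra! hnp
    have := ha.half_le_norm_of_mem_closedBall hn
    linarith [ha.antitone hnp, mem_ball_zero_iff.1 hzt]
  obtain ⟨j, rfl⟩ := Nat.exists_eq_add_of_le (Nat.succ_le_of_lt hpn)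
  refine mem_iUnion_of_mem j (closedBall_subset_closedBall ?_ hn)
  have hdecay : a (p + 1 + j) ≤ (1 / 2) ^ j * (2 * t) := by
    refine (ha.add_le (p + 1) j).trans ?_
    have := ha.pos (p + 1)
    gcongr
    norm_num
  have hindex : (M : ℝ) + 1 ≤ (p + 1 + j : ℕ) + 1 := by
    gcongr
    lia
  have ht : 0 < t := by linarith [ha.pos (p + 1)]
  calc a (p + 1 + j) / (2 * √((p + 1 + j : ℕ) + 1))
      ≤ (1 / 2) ^ j * (2 * t) / (2 * √(M + 1)) := by gcongr
    _ = (1 / 2) ^ j * (t / √(M + 1)) := by ring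

theorem volume_ball_inter_exceptionalSet_le (ha : IsSparse φ a) {M : ℕ} {t : ℝ} (ht : 0 < t)
    (htM : 2 * t ≤ a M) :
    volume (ball 0 t ∩ exceptionalSet a) ≤
      2 * ENNReal.ofReal (1 / √(M + 1)) ^ 2 * volume (ball (0 : ℂ) t) := by
  obtain ⟨p, hMp, hp, hp'⟩ := ha.exists_succ_lt_le (by positivity) htM
  calc volume (ball 0 t ∩ exceptionalSet a) ≤ 2 * volume (ball (0 : ℂ) (t / √(M + 1))) :=
        (measure_mono (ha.ball_inter_exceptionalSet_subset hMp hp hp')).trans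
          (volume_iUnion_closedBall_le fun _ => le_rfl)
    _ = 2 * ENNReal.ofReal (1 / √(M + 1)) ^ 2 * volume (ball (0 : ℂ) t) := by
      rw [Complex.volume_ball, Complex.volume_ball, div_eq_mul_one_div t, ENNReal.ofReal_mul ht.le]
      ring

theorem tendsto_volume_exceptionalSet (ha : IsSparse φ a) :
    Tendsto (fun t => volume (ball 0 t ∩ exceptionalSet a) / volume (ball (0 : ℂ) t))
      (𝓝[>] 0) (𝓝 0) := by
  have hlim : Tendsto (fun M : ℕ => 2 * ENNReal.ofReal (1 / √((M : ℝ) + 1)) ^ 2) atTop (𝓝 0) := by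
    simpa using ENNReal.Tendsto.const_mul
      (ENNReal.Tendsto.pow (n := 2) (ENNReal.tendsto_ofReal (tendsto_const_div_sqrt 1)))
      (.inr ENNReal.ofNat_ne_top)
  refine ENNReal.tendsto_nhds_zero.2 fun ε hε => ?_
  obtain ⟨M, hM⟩ := (hlim.eventually_le_const hε).exists
  filter_upwards [Ioo_mem_nhdsGT (half_pos (ha.pos M))] with t ⟨ht, htM⟩
  rw [ENNReal.div_le_iff (measure_ball_pos volume _ ht).ne' measure_ball_lt_top.ne]
  refine (ha.volume_ball_inter_exceptionalSet_le ht (by linarith)).trans ?_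
  gcongr

end IsSparse

end Density

section Holes

variable {φ : ℝ → ℝ} {a r : ℕ → ℝ} {α : ℝ≥0}

/-- The radii of the removed disks; the indices start at `0`, whence the shift `n + 1`. -/
def holeRadius (φ : ℝ → ℝ) (a : ℕ → ℝ) (α : ℝ≥0) (n : ℕ) : ℝ :=
  (a n ^ 2 * ((n : ℝ) + 1)⁻¹ * φ (a n)) ^ (1 + (α : ℝ))⁻¹

theorem perforatedDisk_subset (a r : ℕ → ℝ) (N : ℕ) :
    perforatedDisk a r ⊆ ball 0 1 \ ⋃ n ∈ Finset.range N, closedBall (a n : ℂ) (r n) :=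
  sdiff_subset_sdiff_right (iUnion_mono fun _ => iUnion_subset fun _ => Subset.rfl)

namespace IsSparse

theorem le_half (ha : IsSparse φ a) (n : ℕ) : a n ≤ 1 / 2 :=
  (ha.antitone n.zero_le).trans ha.apply_zero_le

theorem holeRadius_base_pos (ha : IsSparse φ a) (hφ : IsAdmissible φ) (n : ℕ) :
    0 < a n ^ 2 * ((n : ℝ) + 1)⁻¹ * φ (a n) := by
  have hpos := ha.pos n
  have := hφ.pos _ hpos
  positivity

theorem holeRadius_pos (ha : IsSparse φ a) (hφ : IsAdmissible φ) (n : ℕ) :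
    0 < holeRadius φ a α n :=
  Real.rpow_pos_of_pos (ha.holeRadius_base_pos hφ n) _

theorem holeRadius_rpow (ha : IsSparse φ a) (hφ : IsAdmissible φ) (n : ℕ) :
    holeRadius φ a α n ^ (1 + (α : ℝ)) = a n ^ 2 * ((n : ℝ) + 1)⁻¹ * φ (a n) :=
  Real.rpow_inv_rpow (ha.holeRadius_base_pos hφ n).le (by positivity)

theorem phi_le (ha : IsSparse φ a) (hφ : IsAdmissible φ) (n : ℕ) : φ (a n) ≤ 1 / 16 :=
  (hφ.mono (ha.pos n) (ha.pos 0) (ha.antitone n.zero_le)).trans ha.phi_zero_le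

theorem holeRadius_le (ha : IsSparse φ a) (hφ : IsAdmissible φ) (hα : α ≤ 1) (n : ℕ) :
    holeRadius φ a α n ≤ a n / (4 * √(n + 1)) := by
  have hpos := ha.pos n
  have hsqrt : 1 ≤ √((n : ℝ) + 1) := Real.one_le_sqrt.2 (by simp)
  have hle_one : a n / (4 * √(n + 1)) ≤ 1 :=
    div_le_one_of_le₀ (by linarith [ha.le_half n]) (by positivity)
  have hexp : 1 + (α : ℝ) ≤ 2 := by
    have : (α : ℝ) ≤ 1 := mod_cast hα
    linarith
  refine (Real.rpow_inv_le_iff_of_pos (ha.holeRadius_base_pos hφ n).le (by positivity)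
    (by positivity)).2 ?_
  calc a n ^ 2 * ((n : ℝ) + 1)⁻¹ * φ (a n) ≤ a n ^ 2 * ((n : ℝ) + 1)⁻¹ * (1 / 16) := by
        gcongr
        exact ha.phi_le hφ n
    _ = (a n / (4 * √(n + 1))) ^ (2 : ℝ) := by
      rw [Real.rpow_two, div_pow, mul_pow, Real.sq_sqrt (by positivity)]
      field_simp
      norm_num
    _ ≤ (a n / (4 * √(n + 1))) ^ (1 + (α : ℝ)) :=
      Real.rpow_le_rpow_of_exponent_ge (by positivity) hle_one hexp

theorem holeRadius_le_quarter (ha : IsSparse φ a) (hφ : IsAdmissible φ) (hα : α ≤ 1) (n : ℕ) :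
    holeRadius φ a α n ≤ a n / 4 := by
  have hpos := ha.pos n
  refine (ha.holeRadius_le hφ hα n).trans ?_
  gcongr
  linarith [Real.one_le_sqrt.2 (show (1 : ℝ) ≤ n + 1 by simp)]

theorem norm_mem_Icc (ha : IsSparse φ a) (hr : ∀ n, r n ≤ a n / 4) {n : ℕ} {z : ℂ}
    (hz : z ∈ closedBall (a n : ℂ) (r n)) : ‖z‖ ∈ Icc (3 / 4 * a n) (5 / 4 * a n) := by
  have hdist : |‖z‖ - a n| ≤ r n := by
    rw [← ha.norm_coe n]
    exact (abs_norm_sub_norm_le _ _).trans (mem_closedBall_iff_norm.1 hz)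
  have := abs_sub_le_iff.1 hdist
  constructor <;> linarith [hr n]

theorem closedBall_subset_annulus (ha : IsSparse φ a) (hr : ∀ n, r n ≤ a n / 4) {n k : ℕ}
    (hk : a n = 3 / 4 * ((2 : ℝ) ^ k)⁻¹) : closedBall (a n : ℂ) (r n) ⊆ annulus 0 k := by
  intro z hz
  obtain ⟨hlower, hupper⟩ := ha.norm_mem_Icc hr hz
  have : (0 : ℝ) < (2 ^ k)⁻¹ := by positivity
  simp only [annulus, mem_ofPred_eq, sub_zero, pow_succ, mul_inv]
  constructor <;> linarith

theorem isHoleFamily (ha : IsSparse φ a) (hr0 : ∀ n, 0 < r n) (hr : ∀ n, r n ≤ a n / 4) (N : ℕ) :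
    IsHoleFamily (Finset.range N) (fun n => (a n : ℂ)) r 0 1 where
  radius_pos n _ := hr0 n
  subset_ball n _ z hz := mem_ball_zero_iff.2 (by
    linarith [(ha.norm_mem_Icc hr hz).2, ha.le_half n])
  pairwiseDisjoint := by
    refine ((pairwise_disjoint_on _).2 fun i j hij => ?_).set_pairwise _
    refine Set.disjoint_left.2 fun z hi hj => ?_
    linarith [(ha.norm_mem_Icc hr hi).1, (ha.norm_mem_Icc hr hj).2, ha.four_mul_le hij, ha.pos j]

theorem zero_mem_perforatedDisk (ha : IsSparse φ a) (hr : ∀ n, r n ≤ a n / 4) :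
    (0 : ℂ) ∈ perforatedDisk a r := by
  refine ⟨mem_ball_self one_pos, fun h => ?_⟩
  obtain ⟨n, hn⟩ := mem_iUnion.1 h
  linarith [(ha.norm_mem_Icc hr hn).1, norm_zero (E := ℂ), ha.pos n]

theorem exists_sdiff_holes_subset (ha : IsSparse φ a) (hr : ∀ n, r n ≤ a n / 4) {ρ : ℝ}
    (hρ : 0 < ρ) :
    ∃ N : ℕ, ball 0 1 \ ⋃ n ∈ Finset.range N, closedBall (a n : ℂ) (r n) ⊆
      perforatedDisk a r ∪ ball 0 ρ := by
  obtain ⟨N, hN⟩ := ha.exists_lt (half_pos hρ)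
  refine ⟨N, fun z hz => or_iff_not_imp_right.2 fun hzρ => ⟨hz.1, fun h => ?_⟩⟩
  obtain ⟨n, hn⟩ := mem_iUnion.1 h
  rw [mem_ball_zero_iff, not_lt] at hzρ
  rcases lt_or_ge n N with hnN | hnN
  · exact hz.2 (mem_iUnion₂_of_mem (Finset.mem_range.2 hnN) hn)
  · linarith [(ha.norm_mem_Icc hr hn).2, ha.antitone hnN]

theorem isOpen_perforatedDisk_sdiff_zero (ha : IsSparse φ a) (hr : ∀ n, r n ≤ a n / 4) :
    IsOpen (perforatedDisk a r \ {0}) := by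
  refine isOpen_iff_mem_nhds.2 fun z ⟨hz, hz0⟩ => ?_
  have hρ : 0 < ‖z‖ / 2 := half_pos (norm_pos_iff.2 hz0)
  obtain ⟨N, hN⟩ := ha.exists_sdiff_holes_subset hr hρ
  have hopen : IsOpen ((ball 0 1 \ ⋃ n ∈ Finset.range N, closedBall (a n : ℂ) (r n)) \
      closedBall 0 (‖z‖ / 2)) :=
    IsOpen.sdiff (isOpen_ball_sdiff_holes _ (fun n => (a n : ℂ)) r 0 1) isClosed_closedBall
  refine mem_of_superset (hopen.mem_nhds ⟨perforatedDisk_subset a r N hz, ?_⟩) ?_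
  · rw [mem_closedBall_zero_iff]
    linarith
  · rintro w ⟨hw, hwρ⟩
    refine ⟨(hN hw).resolve_right (mt (ball_subset_closedBall ·) hwρ), ?_⟩
    rintro rfl
    exact hwρ (mem_closedBall_self hρ.le)

theorem exists_analyticOnNhd (ha : IsSparse φ a) (hr : ∀ n, r n ≤ a n / 4) {f : ℂ → ℂ}
    (hf : AnalyticOnNhd ℂ f (perforatedDisk a r)) :
    ∃ N : ℕ, AnalyticOnNhd ℂ f
      (ball 0 1 \ ⋃ n ∈ Finset.range N, closedBall (a n : ℂ) (r n)) := by
  obtain ⟨ρ, hρ, hanalytic⟩ :=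
    eventually_nhds_iff_ball.1 (hf 0 (ha.zero_mem_perforatedDisk hr)).eventually_analyticAt
  obtain ⟨N, hN⟩ := ha.exists_sdiff_holes_subset hr hρ
  exact ⟨N, fun z hz => (hN hz).elim (hf z) (hanalytic z)⟩

theorem mem_perforatedDisk (ha : IsSparse φ a) (hr : ∀ n, r n ≤ a n / (4 * √(n + 1))) {y : ℂ}
    (hy1 : ‖y‖ < 1) (hy : y ∉ exceptionalSet a) : y ∈ perforatedDisk a r := by
  refine ⟨mem_ball_zero_iff.2 hy1, mt (fun h => ?_) hy⟩
  refine iUnion_mono (fun n => closedBall_subset_closedBall ((hr n).trans ?_)) h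
  have := ha.pos n
  gcongr
  norm_num

end IsSparse

end Holes

section TaylorEstimate

variable {φ : ℝ → ℝ} {a r : ℕ → ℝ} {α : ℝ≥0} {y : ℂ}

namespace IsSparse

theorem inv_abs_dist_zero_sub_le (ha : IsSparse φ a) (hr : ∀ n, r n ≤ a n / 4) (n : ℕ) :
    |dist 0 (a n : ℂ) - r n|⁻¹ ≤ 4 / 3 * (a n)⁻¹ := by
  have hpos := ha.pos n
  have hgap : 3 / 4 * a n ≤ |dist 0 (a n : ℂ) - r n| := by
    rw [dist_zero_left, ha.norm_coe]
    exact le_abs.2 (.inl (by linarith [hr n]))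
  calc |dist 0 (a n : ℂ) - r n|⁻¹ ≤ (3 / 4 * a n)⁻¹ := by gcongr
    _ = 4 / 3 * (a n)⁻¹ := by rw [mul_inv, inv_div]

theorem inv_abs_dist_sub_le (ha : IsSparse φ a) (hr : ∀ n, r n ≤ a n / (4 * √(n + 1)))
    (hy : y ∉ exceptionalSet a) (n : ℕ) : |dist y (a n) - r n|⁻¹ ≤ 2 * ‖y - a n‖⁻¹ := by
  have hpos := ha.pos n
  have hfar := lt_norm_sub_of_notMem_exceptionalSet hy n
  have hdist : 0 < ‖y - a n‖ := lt_trans (by positivity) hfar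
  have hgap : 1 / 2 * ‖y - a n‖ ≤ |dist y (a n) - r n| := by
    rw [dist_eq_norm]
    refine le_abs.2 (.inl ?_)
    have hhalf : a n / (4 * √(n + 1)) = 1 / 2 * (a n / (2 * √(n + 1))) := by ring
    linarith [hr n]
  calc |dist y (a n) - r n|⁻¹ ≤ (1 / 2 * ‖y - a n‖)⁻¹ := by gcongr
    _ = 2 * ‖y - a n‖⁻¹ := by rw [mul_inv, inv_div, div_one]

theorem holeRadius_mul_remainder_le (ha : IsSparse φ a) (hφ : IsAdmissible φ) (hα : α ≤ 1)
    (hy : y ∉ exceptionalSet a) (K : ℝ≥0) (n : ℕ) :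
    holeRadius φ a α n * (‖y‖ ^ 2 * |dist 0 (a n : ℂ) - holeRadius φ a α n|⁻¹ ^ 2 *
      |dist y (a n) - holeRadius φ a α n|⁻¹ * (K * holeRadius φ a α n ^ (α : ℝ))) ≤
      4 * K * ‖y‖ ^ 2 * interaction φ a y n := by
  have hr := ha.holeRadius_pos hφ (α := α) n
  have hpow : holeRadius φ a α n * holeRadius φ a α n ^ (α : ℝ) =
      a n ^ 2 * ((n : ℝ) + 1)⁻¹ * φ (a n) := by
    rw [← ha.holeRadius_rpow hφ, Real.rpow_add hr, Real.rpow_one]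
  have hpos := ha.pos n
  have hint := ha.interaction_nonneg hφ y n
  calc _ ≤ holeRadius φ a α n * (‖y‖ ^ 2 * (4 / 3 * (a n)⁻¹) ^ 2 * (2 * ‖y - a n‖⁻¹) *
        (K * holeRadius φ a α n ^ (α : ℝ))) := by
        gcongr
        exacts [ha.inv_abs_dist_zero_sub_le (ha.holeRadius_le_quarter hφ hα) n,
          ha.inv_abs_dist_sub_le (ha.holeRadius_le hφ hα) hy n]
    _ = 32 / 9 * K * ‖y‖ ^ 2 *
        (holeRadius φ a α n * holeRadius φ a α n ^ (α : ℝ) * (a n)⁻¹ ^ 2 * ‖y - a n‖⁻¹) := by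
      ring
    _ = 32 / 9 * K * ‖y‖ ^ 2 * interaction φ a y n := by
      rw [hpow, interaction]
      field_simp
    _ ≤ 4 * K * ‖y‖ ^ 2 * interaction φ a y n := by
      gcongr
      norm_num

theorem norm_taylor_le_interaction (ha : IsSparse φ a) (hφ : IsAdmissible φ) (hα0 : 0 < α)
    (hα1 : α ≤ 1) (hy1 : ‖y‖ ≤ 1 / 2) (hy : y ∉ exceptionalSet a) {f : ℂ → ℂ}
    (hf : f ∈ analyticLip α (perforatedDisk a (holeRadius φ a α))) :
    ∃ N : ℕ, ‖f y - f 0 - deriv f 0 * y‖ ≤ 2 * ‖y‖ ^ 2 * (⨆ z, ‖f z‖) +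
      4 * nnHolderNorm α f * ‖y‖ ^ 2 * ∑ n ∈ Finset.range N, interaction φ a y n := by
  obtain ⟨⟨⟨hhol, hbdd⟩, _⟩, hanalytic⟩ := hf
  have hquarter := ha.holeRadius_le_quarter hφ hα1
  obtain ⟨N, hN⟩ := ha.exists_analyticOnNhd hquarter hanalytic
  have hB (z : ℂ) : ‖f z‖ ≤ ⨆ z, ‖f z‖ := le_ciSup hbdd z
  have hK (n : ℕ) (z : ℂ) (hz : z ∈ sphere (a n : ℂ) (holeRadius φ a α n)) :
      ‖f z - f (a n)‖ ≤ nnHolderNorm α f * holeRadius φ a α n ^ (α : ℝ) := by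
    simpa only [dist_eq_norm, mem_sphere_iff_norm.1 hz] using hhol.holderWith.dist_le z (a n)
  have htaylor := (ha.isHoleFamily (ha.holeRadius_pos hφ) hquarter N).norm_taylor_le
    (hhol.holderWith.continuous hα0).continuousOn hN.differentiableOn (fun z _ => hB z)
    (fun n _ => hK n)
    (perforatedDisk_subset _ _ N (ha.zero_mem_perforatedDisk hquarter))
    (perforatedDisk_subset _ _ N
      (ha.mem_perforatedDisk (ha.holeRadius_le hφ hα1) (hy1.trans_lt one_half_lt_one) hy))
  have houter : |dist y 0 - 1|⁻¹ ≤ 2 := by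
    refine inv_le_of_inv_le₀ two_pos (le_abs.2 (.inr ?_))
    rw [dist_zero_right]
    linarith
  refine ⟨N, ?_⟩
  rw [sub_zero, smul_eq_mul, mul_comm y, dist_self, zero_sub, abs_neg, abs_one] at htaylor
  have hB0 : 0 ≤ ⨆ z, ‖f z‖ := (norm_nonneg _).trans (hB 0)
  refine htaylor.trans (add_le_add ?_ ?_)
  · calc _ = ‖y‖ ^ 2 * |dist y 0 - 1|⁻¹ * ⨆ z, ‖f z‖ := by ring
      _ ≤ ‖y‖ ^ 2 * 2 * ⨆ z, ‖f z‖ := by gcongr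
      _ = _ := by ring
  · rw [Finset.mul_sum]
    exact Finset.sum_le_sum fun n _ => ha.holeRadius_mul_remainder_le hφ hα1 hy _ n

theorem exists_norm_taylor_le (ha : IsSparse φ a) (hφ : IsAdmissible φ) (hα0 : 0 < α)
    (hα1 : α ≤ 1) {ε : ℝ} (hε : 0 < ε) :
    ∃ R > 0, ∀ y : ℂ, ‖y‖ < R → y ∉ exceptionalSet a →
      ∀ f ∈ analyticLip α (perforatedDisk a (holeRadius φ a α)),
        ‖f y - f 0 - deriv f 0 * y‖ ≤ ε * φ ‖y‖ * ‖y‖ * lipNorm α f := by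
  obtain ⟨R₁, hR₁, hinteraction⟩ := ha.exists_sum_interaction_le hφ (show 0 < ε / 4 by positivity)
  obtain ⟨R₂, hR₂ : 0 < R₂, hψ⟩ := mem_nhdsGT_iff_exists_Ioo_subset.1
    (hφ.assoc_tendsto.eventually_le_const (show 0 < ε / 2 by positivity))
  refine ⟨min (1 / 2) (min R₁ R₂), by positivity, fun y hyR hy f hf => ?_⟩
  simp only [lt_min_iff] at hyR
  obtain ⟨hy1, hyR₁, hyR₂⟩ := hyR
  rcases eq_or_ne y 0 with rfl | hy0
  · simp
  have hynorm : 0 < ‖y‖ := norm_pos_iff.2 hy0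
  have hφy := hφ.pos _ hynorm
  have hyψ : ‖y‖ ≤ ε / 2 * φ ‖y‖ := (div_le_iff₀ hφy).1 (hψ ⟨hynorm, hyR₂⟩)
  obtain ⟨N, hN⟩ := ha.norm_taylor_le_interaction hφ hα0 hα1 hy1.le hy hf
  have hB0 : 0 ≤ ⨆ z, ‖f z‖ := Real.iSup_nonneg fun z => norm_nonneg (f z)
  calc _ ≤ _ := hN
    _ ≤ 2 * (‖y‖ * (ε / 2 * φ ‖y‖)) * (⨆ z, ‖f z‖) +
        4 * nnHolderNorm α f * ‖y‖ ^ 2 * (ε / 4 * (φ ‖y‖ / ‖y‖)) := by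
      rw [sq]
      gcongr
      exact hinteraction y hy0 hyR₁ hy N
    _ = ε * φ ‖y‖ * ‖y‖ * lipNorm α f := by
      rw [lipNorm]
      field_simp
      ring

theorem hasFullAreaDensity (ha : IsSparse φ a) (hφ : IsAdmissible φ) (hα0 : 0 < α) (hα1 : α ≤ 1)
    {ε : ℝ} (hε : 0 < ε) :
    HasFullAreaDensity {y | y ∈ perforatedDisk a (holeRadius φ a α) ∧
      ∀ f ∈ analyticLip α (perforatedDisk a (holeRadius φ a α)),
        ‖f y - f 0 - deriv f 0 * y‖ ≤ ε * φ ‖y‖ * ‖y‖ * lipNorm α f} 0 := by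
  obtain ⟨R, hR, htaylor⟩ := ha.exists_norm_taylor_le hφ hα0 hα1 hε
  refine tendsto_of_tendsto_of_tendsto_of_le_of_le' tendsto_const_nhds
    ha.tendsto_volume_exceptionalSet (.of_forall fun _ => zero_le) ?_
  filter_upwards [Ioo_mem_nhdsGT (lt_min hR one_pos)] with t ⟨_, ht⟩
  refine ENNReal.div_le_div_right (measure_mono ?_) _
  rintro y ⟨hyt, hyE⟩
  refine ⟨hyt, ?_⟩
  by_contra hy
  obtain ⟨hyR, hy1⟩ := lt_min_iff.1 ((mem_ball_zero_iff.1 hyt).trans ht)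
  exact hyE ⟨ha.mem_perforatedDisk (ha.holeRadius_le hφ hα1) hy1 hy, htaylor y hyR hy⟩

end IsSparse

end TaylorEstimate

section ContentSum

variable {φ : ℝ → ℝ} {a r : ℕ → ℝ} {k : ℕ → ℕ} {α : ℝ≥0}

theorem tsum_ofReal_const_div_eq_top {c : ℝ} (hc : 0 < c) :
    ∑' n : ℕ, ENNReal.ofReal (c / (n + 1)) = ⊤ := by
  by_contra hfinite
  have hsummable : Summable fun n : ℕ => c / ((n : ℝ) + 1) :=
    (ENNReal.summable_toReal hfinite).congr fun n => ENNReal.toReal_ofReal (by positivity)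
  refine Real.not_summable_one_div_natCast ((summable_nat_add_iff 1).1 ?_)
  refine (hsummable.mul_left c⁻¹).congr fun n => ?_
  push_cast
  field_simp

theorem ofReal_rpow_le_lowerHausdorffContent {β : ℝ} (hβ0 : 0 < β) (hβ2 : β < 2) {n m : ℕ}
    (hr : 0 < r n) (hann : closedBall (a n : ℂ) (r n) ⊆ annulus 0 m) :
    ENNReal.ofReal (r n ^ β) ≤ lowerHausdorffContent β (annulus 0 m \ perforatedDisk a r) := by
  have hdisk := rpow_le_lowerHausdorffContent_closedBall hβ0 hβ2 (a n : ℂ)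
    (Real.toNNReal_pos.2 hr)
  rw [← ENNReal.ofReal_coe_nnreal, NNReal.coe_rpow, Real.coe_toNNReal _ hr.le] at hdisk
  exact hdisk.trans (lowerHausdorffContent_mono β
    fun z hz => ⟨hann hz, fun h => h.2 (mem_iUnion_of_mem n hz)⟩)

namespace IsSparse

theorem const_div_le_weight_mul_holeRadius_rpow (ha : IsSparse φ a) (hφ : IsAdmissible φ)
    {n m : ℕ} (hm : a n = 3 / 4 * ((2 : ℝ) ^ m)⁻¹) :
    9 / 32 / ((n : ℝ) + 1) ≤
      (φ ((2 ^ m)⁻¹))⁻¹ * 4 ^ m * holeRadius φ a α n ^ (1 + (α : ℝ)) := by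
  have hscale : (0 : ℝ) < (2 ^ m)⁻¹ := by positivity
  have hφm := hφ.pos _ hscale
  have hdouble : φ ((2 ^ m)⁻¹) ≤ 2 * φ (a n) := hφ.le_two_mul (ha.pos n) hscale (by linarith)
  have hsq : (4 : ℝ) ^ m * a n ^ 2 = 9 / 16 := by
    rw [hm, show (4 : ℝ) = 2 ^ 2 by norm_num, pow_right_comm]
    field_simp
    norm_num
  calc 9 / 32 / ((n : ℝ) + 1)
      = 9 / 32 / (n + 1) * ((φ ((2 ^ m)⁻¹))⁻¹ * φ ((2 ^ m)⁻¹)) := by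
        rw [inv_mul_cancel₀ hφm.ne', mul_one]
    _ ≤ 9 / 32 / (n + 1) * ((φ ((2 ^ m)⁻¹))⁻¹ * (2 * φ (a n))) := by gcongr
    _ = (φ ((2 ^ m)⁻¹))⁻¹ * (4 ^ m * a n ^ 2) * ((n + 1 : ℝ)⁻¹ * φ (a n)) := by
      rw [hsq]
      ring
    _ = _ := by
      rw [ha.holeRadius_rpow hφ]
      ring

theorem tsum_lowerHausdorffContent_eq_top (ha : IsSparse φ a) (hφ : IsAdmissible φ) (hα : α < 1)
    (hk : StrictMono k) (hk0 : 1 ≤ k 0) (hak : ∀ n, a n = 3 / 4 * ((2 : ℝ) ^ k n)⁻¹) :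
    ∑' n : ℕ, ENNReal.ofReal ((φ (((2 : ℝ) ^ (n + 1))⁻¹))⁻¹ * 4 ^ (n + 1)) *
      lowerHausdorffContent (1 + (α : ℝ))
        (annulus 0 (n + 1) \ perforatedDisk a (holeRadius φ a α)) = ⊤ := by
  obtain ⟨j, hj⟩ : ∃ j : ℕ → ℕ, ∀ n, j n + 1 = k n :=
    ⟨fun n => k n - 1, fun n => Nat.sub_add_cancel (hk0.trans (hk.monotone n.zero_le))⟩
  have hj_inj : Function.Injective j := fun m n h => hk.injective (by rw [← hj, ← hj, h])
  rw [eq_top_iff, ← tsum_ofReal_const_div_eq_top (show (0 : ℝ) < 9 / 32 by norm_num)]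
  refine le_trans (ENNReal.tsum_le_tsum fun n => ?_)
    (ENNReal.tsum_comp_le_tsum_of_injective hj_inj _)
  have hr := ha.holeRadius_pos hφ (α := α) n
  have hball := ha.closedBall_subset_annulus (ha.holeRadius_le_quarter hφ hα.le) (hak n)
  have hweight : 0 ≤ (φ ((2 ^ k n)⁻¹))⁻¹ * 4 ^ k n := by
    have := hφ.pos ((2 ^ k n)⁻¹) (by positivity)
    positivity
  simp only [hj]
  calc _ ≤ _ := ENNReal.ofReal_le_ofReal (ha.const_div_le_weight_mul_holeRadius_rpow hφ (hak n))
    _ = _ := ENNReal.ofReal_mul hweight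
    _ ≤ _ := by
      gcongr
      have hβ2 : 1 + (α : ℝ) < 2 := by linarith [show (α : ℝ) < 1 from mod_cast hα]
      exact ofReal_rpow_le_lowerHausdorffContent (by positivity) hβ2 hr hball

end IsSparse

end ContentSum

end LipAnalytic

end

theorem theorem4p1 (φ : ℝ → ℝ) (hφ : IsAdmissible φ) (hφ0 : Tendsto φ (𝓝[>] 0) (𝓝 0))
    (α : ℝ≥0) (hα0 : 0 < α) (hα1 : α < 1) :
    ∃ (k : ℕ → ℕ) (a r : ℕ → ℝ) (U : Set ℂ),
      -- the `n`-th disk (counting from `n + 1 = 1`) is centred in the annulus `A_{k n}(0)`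
      StrictMono k ∧ 1 ≤ k 0 ∧
      (∀ n, a n = 3 / 4 * ((2 : ℝ) ^ k n)⁻¹) ∧
      (∀ n, 0 < r n ∧ r n ^ (1 + (α : ℝ)) = a n ^ 2 * ((n : ℝ) + 1)⁻¹ * φ (a n)) ∧
      (∀ n, closedBall (a n : ℂ) (r n) ⊆ annulus 0 (k n)) ∧
      U = perforatedDisk a r ∧ (0 : ℂ) ∈ U ∧ IsOpen (U \ {0}) ∧
      (∀ ε : ℝ, 0 < ε →
        HasFullAreaDensity
          {y | y ∈ U ∧ ∀ f ∈ analyticLip α U,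
            ‖f y - f 0 - deriv f 0 * y‖ ≤ ε * φ ‖y‖ * ‖y‖ * lipNorm α f} 0) ∧
      ∑' n : ℕ, ENNReal.ofReal ((φ (((2 : ℝ) ^ (n + 1))⁻¹))⁻¹ * 4 ^ (n + 1)) *
        lowerHausdorffContent (1 + (α : ℝ)) (annulus 0 (n + 1) \ U) = ⊤ := by
  obtain ⟨k, hk, hk0, ha⟩ := hφ.exists_isSparse hφ0
  have hr := ha.holeRadius_le_quarter hφ hα1.le
  exact ⟨k, _, holeRadius φ _ α, _, hk, hk0, fun _ => rfl,
    fun n => ⟨ha.holeRadius_pos hφ n, ha.holeRadius_rpow hφ n⟩,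
    fun _ => ha.closedBall_subset_annulus hr rfl,
    rfl, ha.zero_mem_perforatedDisk hr, ha.isOpen_perforatedDisk_sdiff_zero hr,
    fun _ hε => ha.hasFullAreaDensity hφ hα0 hα1.le hε,
    ha.tsum_lowerHausdorffContent_eq_top hφ hα1 hk hk0 fun _ => rfl⟩
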